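/- Throughout, $A$ is a (not necessarily unital) pro-$C^*$-algebra: a complete Hausdorff complex topological $*$-algebra whose topology is determined by the set $S(A)$ of all its continuous $C^*$-seminorms. A Hilbert $A$-module is a complex vector space $E$ with a compatible right $A$-action and an $A$-valued inner product $\langle\cdot,\cdot\rangle$, $\mathbb C$- and $A$-linear in the second variable, hermitian and positive definite, which is complete for the seminorms $\overline p_E(\xi)=p(\langle\xi,\xi\rangle)^{1/2}$, $p\in S(A)$. $L(E,F)$ is the space of adjointable module morphisms $E\to F$, $L(E)=L(E,E)$, and $b(L(E))$ is the algebra of those $T\in L(E)$ for which there is a constant $M$ with $\overline p_E(T\xi)\le M\,\overline p_E(\xi)$ for all $p\in S(A)$, $\xi\in E$. $A$ is a Hilbert module over itself with $\langle a,b\rangle=a^*b$, and $H_A$ is the Hilbert $A$-module of all sequences $(a_n)_n$ in $A$ for which $\sum_n a_n^*a_n$ converges in $A$, with $\langle (a_n)_n,(b_n)_n\rangle=\sum_n a_n^*b_n$. The multiplier module of $E$ is $M(E)=L(A,E)$; for $h\in M(E)$, $\xi\in E$ put $\langle h,\xi\rangle=h^*(\xi)\in A$, $\langle \xi,h\rangle=\langle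 h,\xi\rangle^*$ and $h\cdot a=h(a)$ for $a\in A$. $E$ is countably generated in $M(E)$ if there is a sequence $(g_n)_n$ in $M(E)$ such that the closed submodule generated by all $g_n\cdot a$ ($a\in A$, $n\ge 1$) is $E$. A sequence $\{h_n\}_n$ in $M(E)$ is a standard frame of multipliers in $E$ if for every $\xi\in E$ the series $\sum_n\langle\xi,h_n\rangle\langle h_n,\xi\rangle$ converges in $A$ and there are constants $C,D>0$ such that $$C\langle\xi,\xi\rangle\le\sum_n\langle\xi,h_n\rangle\langle h_n,\xi\rangle\le D\langle\xi,\xi\rangle\qquad\text{for all }\xi\in E;$$ it is a standard normalised frame of multipliers if this holds with $C=D=1$. The frame transform of a standard frame of multipliers is $\theta:E\to H_A$, $\theta(\xi)=(\langle h_n,\xi\rangle)_n$. **Theorem.** Let $E$ be a Hilbert $A$-module which is countably generated in $M(E)$ and let $\{h_n\}_n$ be a sequence in $M(E)$. Then $\{h_n\}_n$ is a standard frame of multipliers in $E$ if and only if there is an invertible element $T$ of the algebra $b(L(E))$ such that $\{T\circ h_n\}_n$ is a standard normalised frame of multipliers in $E$. Moreover, if $\{h_n\}_n$ is a standard frame of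 multipliers in $E$, then its frame transform $\theta$ is adjointable and one can take $T=(\theta^*\circ\theta)^{-1/2}$, that is, there is a positive $T\in L(E)$ such that $T\circ T$ is the inverse of $\theta^*\circ\theta$, $T$ is an invertible element of $b(L(E))$, and $\{T\circ h_n\}_n$ is a standard normalised frame of multipliers in $E$. -/

import Mathlib

open Filter Topology Finset
open scoped RightActions

noncomputable section

namespace ProCStar

universe u v w

/-! ### The completion of a seminormed *-algebra with a C*-seminorm -/

section Completion

open UniformSpace UniformSpace.Completion

variable (B : Type u) [NonUnitalSeminormedRing B] [NormedSpace ℂ B]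

/-- The completion of a seminormed algebra, as a type carrying a non-unital ring structure. -/
def AlgCompletion : Type u := Completion B

namespace AlgCompletion

instance : NormedAddCommGroup (AlgCompletion B) :=
  inferInstanceAs (NormedAddCommGroup (Completion B))
instance : NormedSpace ℂ (AlgCompletion B) := inferInstanceAs (NormedSpace ℂ (Completion B))
instance : CompleteSpace (AlgCompletion B) := inferInstanceAs (CompleteSpace (Completion B))

/-- The canonical map into the completion. -/
def of : B →ₗᵢ[ℂ] AlgCompletion B := Completion.toComplₗᵢ (𝕜 := ℂ) (E := B)

lemma denseRange_of : DenseRange (of B) := Completion.denseRange_coe (α := B)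

lemma isDenseInducing_of : IsDenseInducing (of B) := Completion.isDenseInducing_coe (α := B)

instance : Mul (AlgCompletion B) :=
  ⟨Function.curry <| ((isDenseInducing_of B).prodMap (isDenseInducing_of B)).extend
    (of B ∘ Function.uncurry (· * ·))⟩

lemma of_mul (a b : B) : of B (a * b) = of B a * of B b :=
  (((isDenseInducing_of B).prodMap (isDenseInducing_of B)).extend_eq
      ((of B).continuous.comp (@continuous_mul B _ _ _)) (a, b)).symm

instance : ContinuousMul (AlgCompletion B) where
  continuous_mul := by
    let o : B →+ AlgCompletion B := (of B).toLinearMap.toAddMonoidHom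
    let m := (AddMonoidHom.mul : B →+ B →+ B).compr₂ o
    have : Continuous fun x : B × B => m x.1 x.2 := (of B).continuous.comp continuous_mul
    have di : IsDenseInducing o := isDenseInducing_of B
    exact (di.extend_Z_bilin di this :)

variable {B} in
lemma ind {P : AlgCompletion B → Prop} (x : AlgCompletion B) (hc : IsClosed {x | P x})
    (h : ∀ b, P (of B b)) : P x :=
  (denseRange_of B).induction_on x hc h

variable {B} in
lemma ind₂ {P : AlgCompletion B → AlgCompletion B → Prop} (x y : AlgCompletion B)
    (hc : IsClosed {x : AlgCompletion B × AlgCompletion B | P x.1 x.2})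
    (h : ∀ a b, P (of B a) (of B b)) : P x y :=
  (denseRange_of B).induction_on₂ hc h x y

variable {B} in
lemma ind₃ {P : AlgCompletion B → AlgCompletion B → AlgCompletion B → Prop}
    (x y z : AlgCompletion B)
    (hc : IsClosed {x : AlgCompletion B × AlgCompletion B × AlgCompletion B | P x.1 x.2.1 x.2.2})
    (h : ∀ a b c, P (of B a) (of B b) (of B c)) : P x y z :=
  (denseRange_of B).induction_on₃ hc h x y z

lemma continuous_smul' (c : ℂ) : Continuous fun x : AlgCompletion B => c • x := by
  exact (lipschitzWith_smul c).continuous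

variable {B} in
lemma smul_mul' [IsScalarTower ℂ B B] (c : ℂ) (x y : AlgCompletion B) :
    (c • x) * y = c • (x * y) := by
  induction x, y using ind₂ with
  | hc => exact isClosed_eq (((continuous_smul' B c).comp continuous_fst).mul continuous_snd)
            ((continuous_smul' B c).comp (continuous_fst.mul continuous_snd))
  | h a b => rw [← map_smul, ← of_mul, ← of_mul, ← map_smul, smul_mul_assoc]

variable {B} in
lemma mul_smul' [SMulCommClass ℂ B B] (c : ℂ) (x y : AlgCompletion B) :
    x * (c • y) = c • (x * y) := by
  induction x, y using ind₂ with
  | hc => exact isClosed_eq (continuous_fst.mul ((continuous_smul' B c).comp continuous_snd))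
            ((continuous_smul' B c).comp (continuous_fst.mul continuous_snd))
  | h a b => rw [← map_smul, ← of_mul, ← of_mul, ← map_smul, mul_smul_comm]

instance : NonUnitalNormedRing (AlgCompletion B) where
  __ := (inferInstance : NormedAddCommGroup (AlgCompletion B))
  left_distrib x y z := by
    induction x, y, z using ind₃ with
    | hc => apply isClosed_eq <;> fun_prop
    | h a b c =>
      simp only [← map_add, ← of_mul, mul_add]
  right_distrib x y z := by
    induction x, y, z using ind₃ with
    | hc => apply isClosed_eq <;> fun_prop
    | h a b c =>
      simp only [← map_add, ← of_mul, add_mul]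
  mul_assoc x y z := by
    induction x, y, z using ind₃ with
    | hc => apply isClosed_eq <;> fun_prop
    | h a b c =>
      simp only [← of_mul, mul_assoc]
  zero_mul x := by
    induction x using ind with
    | hc => apply isClosed_eq <;> fun_prop
    | h a =>
      rw [← map_zero (of B), ← of_mul, zero_mul]
  mul_zero x := by
    induction x using ind with
    | hc => apply isClosed_eq <;> fun_prop
    | h a =>
      rw [← map_zero (of B), ← of_mul, mul_zero]
  norm_mul_le x y := by
    induction x, y using ind₂ with
    | hc => apply isClosed_le <;> fun_prop
    | h a b =>
      simpa only [← of_mul, LinearIsometry.norm_map] using norm_mul_le a b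

instance [IsScalarTower ℂ B B] : IsScalarTower ℂ (AlgCompletion B) (AlgCompletion B) where
  smul_assoc c x y := smul_mul' c x y

instance [SMulCommClass ℂ B B] : SMulCommClass ℂ (AlgCompletion B) (AlgCompletion B) where
  smul_comm c x y := (mul_smul' c x y).symm

variable [StarRing B] [NormedStarGroup B]

instance : Star (AlgCompletion B) := ⟨Completion.map (star : B → B)⟩

lemma of_star (a : B) : of B (star a) = star (of B a) :=
  (Completion.map_coe (uniformContinuous_addMonoidHom_of_continuous
    (f := (starAddEquiv : B ≃+ B).toAddMonoidHom) continuous_star) a).symm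

instance : ContinuousStar (AlgCompletion B) := ⟨Completion.continuous_map⟩

variable {B} in
lemma star_smul' [StarModule ℂ B] (c : ℂ) (x : AlgCompletion B) :
    star (c • x) = star c • star x := by
  induction x using ind with
  | hc => exact isClosed_eq (continuous_smul' B c).star
            ((continuous_smul' B (star c)).comp continuous_star)
  | h a => rw [← map_smul, ← of_star, ← of_star, ← map_smul, star_smul]

instance : StarRing (AlgCompletion B) where
  star_involutive x := by
    induction x using ind with
    | hc => apply isClosed_eq <;> fun_prop
    | h a =>
      rw [← of_star, ← of_star, star_star]
  star_mul x y := by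
    induction x, y using ind₂ with
    | hc => apply isClosed_eq <;> fun_prop
    | h a b =>
      simp only [← of_star, ← of_mul, star_mul]
  star_add x y := by
    induction x, y using ind₂ with
    | hc => apply isClosed_eq <;> fun_prop
    | h a b =>
      simp only [← of_star, ← map_add, star_add]

instance [StarModule ℂ B] : StarModule ℂ (AlgCompletion B) where
  star_smul c x := star_smul' c x

lemma norm_star_mul_self (hB : ∀ b : B, ‖star b * b‖ = ‖b‖ * ‖b‖) (x : AlgCompletion B) :
    ‖star x * x‖ = ‖x‖ * ‖x‖ := by
  induction x using ind with
  | hc => apply isClosed_eq <;> fun_prop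
  | h a =>
    simp only [← of_star, ← of_mul, LinearIsometry.norm_map, hB]

end AlgCompletion

/-- A *-algebra with a C*-seminorm maps isometrically, with dense range, into a C*-algebra. -/
lemma exists_cstar_completion [IsScalarTower ℂ B B] [SMulCommClass ℂ B B] [StarRing B]
    [NormedStarGroup B] [StarModule ℂ B] (hB : ∀ b : B, ‖star b * b‖ = ‖b‖ * ‖b‖) :
    ∃ (C : Type u) (_ : NonUnitalCStarAlgebra C) (φ : B →⋆ₙₐ[ℂ] C), ∀ b, ‖φ b‖ = ‖b‖ := by
  let i : NonUnitalCStarAlgebra (AlgCompletion B) :=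
    { (inferInstance : NonUnitalNormedRing (AlgCompletion B)),
      (inferInstance : StarRing (AlgCompletion B)),
      (inferInstance : NormedSpace ℂ (AlgCompletion B)),
      (inferInstance : CompleteSpace (AlgCompletion B)),
      (inferInstance : IsScalarTower ℂ (AlgCompletion B) (AlgCompletion B)),
      (inferInstance : SMulCommClass ℂ (AlgCompletion B) (AlgCompletion B)),
      (inferInstance : StarModule ℂ (AlgCompletion B)) with
      norm_mul_self_le := fun x => (AlgCompletion.norm_star_mul_self B hB x).ge }
  refine ⟨AlgCompletion B, i,
    { toFun := AlgCompletion.of B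
      map_smul' := fun c b => map_smul _ c b
      map_zero' := map_zero _
      map_add' := map_add _
      map_mul' := AlgCompletion.of_mul B
      map_star' := AlgCompletion.of_star B }, fun b => LinearIsometry.norm_map (AlgCompletion.of B) b⟩

end Completion

/-! ### Pro-C*-algebras -/

/-- A continuous C*-seminorm on a topological *-algebra `A`; the type of all of them is the
set `S(A)`. -/
structure CStarSeminorm (A : Type u) [NonUnitalRing A] [StarRing A] [Module ℂ A]
    [TopologicalSpace A] extends Seminorm ℂ A where
  mul_le : ∀ a b : A, toSeminorm (a * b) ≤ toSeminorm a * toSeminorm b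
  star_mul_self : ∀ a : A, toSeminorm (star a * a) = toSeminorm a * toSeminorm a
  continuous_toSeminorm : Continuous fun a : A => toSeminorm a

/-- A (not necessarily unital) pro-C*-algebra: a complete Hausdorff complex topological *-algebra
whose topology is determined by its continuous C*-seminorms. (Continuity of the multiplication and
of the involution follows from the last axiom.) -/
class ProCStarAlgebra (A : Type u) [NonUnitalRing A] [StarRing A] [Module ℂ A]
    [UniformSpace A] : Prop extends
    IsScalarTower ℂ A A, SMulCommClass ℂ A A, StarModule ℂ A,
    IsUniformAddGroup A, CompleteSpace A, T2Space A where
  withSeminorms : WithSeminorms (fun p : CStarSeminorm A => p.toSeminorm)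

section Algebra

variable {A : Type u} [NonUnitalRing A] [StarRing A] [Module ℂ A]

namespace CStarSeminorm

section Rep

variable [TopologicalSpace A] (p : CStarSeminorm A)

lemma apply_star (a : A) : p.toSeminorm (star a) = p.toSeminorm a := by
  have key : ∀ b : A, p.toSeminorm b ≤ p.toSeminorm (star b) := by
    intro b
    rcases (apply_nonneg p.toSeminorm b).eq_or_lt with h | h
    · rw [← h]; exact apply_nonneg _ _
    · have := p.mul_le (star b) b
      rw [p.star_mul_self] at this
      exact le_of_mul_le_mul_right this h
  exact le_antisymm (by simpa using key (star a)) (key a)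

/-- `A / ker p` embeds isometrically into a C*-algebra. -/
lemma exists_rep [IsScalarTower ℂ A A] [SMulCommClass ℂ A A] [StarModule ℂ A] :
    ∃ (C : Type u) (_ : NonUnitalCStarAlgebra C) (φ : A →⋆ₙₐ[ℂ] C),
      ∀ a, ‖φ a‖ = p.toSeminorm a := by
  let _ : SeminormedAddCommGroup A :=
    AddGroupSeminorm.toSeminormedAddCommGroup p.toSeminorm.toAddGroupSeminorm
  let _ : NonUnitalSeminormedRing A :=
    { ‹SeminormedAddCommGroup A›, ‹NonUnitalRing A› with norm_mul_le := p.mul_le }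
  let _ : NormedSpace ℂ A :=
    { ‹Module ℂ A› with norm_smul_le := fun c a => (map_smul_eq_mul p.toSeminorm c a).le }
  have : NormedStarGroup A := ⟨fun a => (p.apply_star a).le⟩
  exact exists_cstar_completion A p.star_mul_self

variable {p} in
/-- C*-seminorms are monotone on positive elements. -/
lemma mono [IsScalarTower ℂ A A] [SMulCommClass ℂ A A] [StarModule ℂ A] [PartialOrder A]
    [StarOrderedRing A] {a b : A} (ha : 0 ≤ a) (hab : a ≤ b) :
    p.toSeminorm a ≤ p.toSeminorm b := by
  obtain ⟨C, _, φ, hφ⟩ := p.exists_rep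
  let _ : PartialOrder C := CStarAlgebra.spectralOrder C
  have _ : StarOrderedRing C := CStarAlgebra.spectralOrderedRing C
  have h0 : 0 ≤ φ a := by simpa using OrderHomClass.mono φ ha
  have h1 : φ a ≤ φ b := OrderHomClass.mono φ hab
  simpa only [hφ] using CStarAlgebra.norm_le_norm_of_nonneg_of_le h0 h1

end Rep

end CStarSeminorm

section Pro

variable [UniformSpace A] [ProCStarAlgebra A]

lemma tendsto_iff {ι : Type*} {f : Filter ι} (u : ι → A) (a : A) :
    Tendsto u f (𝓝 a) ↔
      ∀ (p : CStarSeminorm A) (ε : ℝ), 0 < ε → ∀ᶠ x in f, p.toSeminorm (u x - a) < ε :=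
  (ProCStarAlgebra.withSeminorms (A := A)).tendsto_nhds u a

lemma continuous_of_seminorm_le (f : A →+ A) (c : CStarSeminorm A → ℝ)
    (h : ∀ p a, p.toSeminorm (f a) ≤ c p * p.toSeminorm a) : Continuous f := by
  refine continuous_iff_continuousAt.2 fun a => (tendsto_iff _ _).2 fun p ε hε => ?_
  have h1 := (tendsto_iff (id : A → A) a).1 tendsto_id p (ε / (|c p| + 1)) (by positivity)
  filter_upwards [h1] with x hx
  rw [lt_div_iff₀ (by positivity)] at hx
  rw [← map_sub]
  have h2 := h p (x - a)
  have h3 : c p ≤ |c p| := le_abs_self _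
  have h4 : 0 ≤ p.toSeminorm (x - a) := apply_nonneg _ _
  simp only [id] at hx
  nlinarith

lemma continuous_mul_left' (a : A) : Continuous fun b : A => a * b :=
  continuous_of_seminorm_le (AddMonoidHom.mulLeft a) (fun p => p.toSeminorm a)
    fun p b => p.mul_le a b

lemma continuous_mul_right' (a : A) : Continuous fun b : A => b * a :=
  continuous_of_seminorm_le (AddMonoidHom.mulRight a) (fun p => p.toSeminorm a)
    fun p b => by rw [mul_comm]; exact p.mul_le b a

lemma continuous_star' : Continuous fun b : A => star b :=
  continuous_of_seminorm_le (starAddEquiv : A ≃+ A).toAddMonoidHom (fun _ => 1)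
    fun p b => by simpa using (p.apply_star b).le

lemma continuous_smul' (c : ℂ) : Continuous fun b : A => c • b :=
  continuous_of_seminorm_le (DistribSMul.toAddMonoidHom A c) (fun _ => ‖c‖)
    fun p b => (map_smul_eq_mul p.toSeminorm c b).le

/-- Comparison test for series of positive elements. -/
lemma exists_tendsto_sum_of_le [PartialOrder A] [StarOrderedRing A] {c d : ℕ → A}
    (hc : ∀ k, 0 ≤ c k) (hcd : ∀ k, c k ≤ d k)
    (hd : ∃ s, Tendsto (fun n => ∑ k ∈ range n, d k) atTop (𝓝 s)) :
    ∃ s, Tendsto (fun n => ∑ k ∈ range n, c k) atTop (𝓝 s) := by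
  have key : ∀ (p : CStarSeminorm A) (m n : ℕ),
      p.toSeminorm (∑ k ∈ range n, c k - ∑ k ∈ range m, c k) ≤
        p.toSeminorm (∑ k ∈ range n, d k - ∑ k ∈ range m, d k) := by
    have aux : ∀ (p : CStarSeminorm A) (m n : ℕ), m ≤ n →
      p.toSeminorm (∑ k ∈ range n, c k - ∑ k ∈ range m, c k) ≤
        p.toSeminorm (∑ k ∈ range n, d k - ∑ k ∈ range m, d k) := by
      intro p m n h
      rw [← sum_Ico_eq_sub _ h, ← sum_Ico_eq_sub _ h]
      exact CStarSeminorm.mono (sum_nonneg fun k _ => hc k) (sum_le_sum fun k _ => hcd k)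
    intro p m n
    rcases le_total m n with h | h
    · exact aux p m n h
    · rw [map_sub_rev, map_sub_rev p.toSeminorm (∑ k ∈ range n, d k)]
      exact aux p n m h
  obtain ⟨s, hs⟩ := hd
  have hcs := hs.cauchySeq
  refine cauchySeq_tendsto_of_complete ?_
  rw [cauchySeq_iff_tendsto, uniformity_eq_comap_nhds_zero, tendsto_comap_iff] at hcs ⊢
  rw [tendsto_iff] at hcs ⊢
  intro p ε hε
  filter_upwards [hcs p ε hε] with x hx
  simp only [Function.comp, Prod.map, sub_zero] at hx ⊢
  exact (key p _ _).trans_lt hx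

end Pro

end Algebra

/-! ### Hilbert modules -/

/-- The laws of a complex vector space `E` with a compatible right `A`-action and a hermitian
`A`-valued form which is `ℂ`- and `A`-linear in its second variable. -/
class IsInnerModule (A : Type u) (E : Type v) [NonUnitalRing A] [StarRing A] [Module ℂ A]
    [AddCommGroup E] [Module ℂ E] [SMul Aᵐᵒᵖ E] [Inner A E] : Prop where
  add_op_smul : ∀ (x y : E) (a : A), (x + y) <• a = x <• a + y <• a
  op_smul_add : ∀ (x : E) (a b : A), x <• (a + b) = x <• a + x <• b
  op_smul_mul : ∀ (x : E) (a b : A), x <• (a * b) = (x <• a) <• b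
  smul_op_smul : ∀ (z : ℂ) (x : E) (a : A), (z • x) <• a = z • (x <• a)
  op_smul_smul : ∀ (z : ℂ) (x : E) (a : A), x <• (z • a) = z • (x <• a)
  inner_add_right : ∀ x y z : E, inner A x (y + z) = inner A x y + inner A x z
  inner_smul_right : ∀ (c : ℂ) (x y : E), inner A x (c • y) = c • inner A x y
  inner_op_smul_right : ∀ (x y : E) (a : A), inner A x (y <• a) = inner A x y * a
  star_inner : ∀ x y : E, star (inner A x y) = inner A y x

/-- A pre-Hilbert (right) `A`-module. -/
class IsPreHilbertModule (A : Type u) (E : Type v) [NonUnitalRing A] [StarRing A] [Module ℂ A]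
    [PartialOrder A] [AddCommGroup E] [Module ℂ E] [SMul Aᵐᵒᵖ E] [Inner A E] : Prop extends
    IsInnerModule A E where
  inner_self_nonneg : ∀ x : E, 0 ≤ inner A x x
  inner_self_eq_zero : ∀ x : E, inner A x x = 0 ↔ x = 0

section Seminorm

variable {A : Type u} [NonUnitalRing A] [StarRing A] [Module ℂ A] [TopologicalSpace A]

/-- The seminorm `p̄_E(x) = √p(⟨x, x⟩)` on a Hilbert module. -/
def CStarSeminorm.onModule (p : CStarSeminorm A) {E : Type v} [Inner A E] (x : E) : ℝ :=
  √(p.toSeminorm (inner A x x))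

end Seminorm

/-- A Hilbert `A`-module: a pre-Hilbert `A`-module which is complete for the uniform structure
determined by the seminorms `p̄_E`, `p ∈ S(A)`. -/
class IsHilbertModule (A : Type u) (E : Type v) [NonUnitalRing A] [StarRing A] [Module ℂ A]
    [PartialOrder A] [TopologicalSpace A] [AddCommGroup E] [Module ℂ E] [SMul Aᵐᵒᵖ E] [Inner A E]
    [UniformSpace E] : Prop extends IsPreHilbertModule A E where
  uniformity_eq : uniformity E =
    ⨅ p : CStarSeminorm A, (𝓝 (0 : ℝ)).comap fun x : E × E => p.onModule (x.1 - x.2)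
  complete : CompleteSpace E

/-! ### Adjointable module morphisms -/

/-- The space `L(E, F)` of adjointable module morphisms `E → F`. The adjoint, which is unique, is
part of the data. -/
structure AdjointableMap (A : Type u) (E : Type v) (F : Type w)
    [AddCommGroup E] [Module ℂ E] [SMul Aᵐᵒᵖ E] [Inner A E]
    [AddCommGroup F] [Module ℂ F] [SMul Aᵐᵒᵖ F] [Inner A F] extends E →ₗ[ℂ] F where
  map_op_smul : ∀ (x : E) (a : A), toFun (x <• a) = toFun x <• a
  adj : F →ₗ[ℂ] E
  adj_op_smul : ∀ (y : F) (a : A), adj (y <• a) = adj y <• a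
  inner_map : ∀ (x : E) (y : F), inner A (toFun x) y = inner A x (adj y)

namespace AdjointableMap

variable {A : Type u} {E : Type v} {F : Type w} {G : Type*}
  [AddCommGroup E] [Module ℂ E] [SMul Aᵐᵒᵖ E] [Inner A E]
  [AddCommGroup F] [Module ℂ F] [SMul Aᵐᵒᵖ F] [Inner A F]
  [AddCommGroup G] [Module ℂ G] [SMul Aᵐᵒᵖ G] [Inner A G]

instance : CoeFun (AdjointableMap A E F) fun _ => E → F := ⟨fun T => T.toFun⟩

/-- Composition of adjointable maps. -/
def comp (S : AdjointableMap A F G) (T : AdjointableMap A E F) : AdjointableMap A E G where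
  toLinearMap := S.toLinearMap.comp T.toLinearMap
  map_op_smul x a := by
    change S (T (x <• a)) = S (T x) <• a
    rw [T.map_op_smul, S.map_op_smul]
  adj := T.adj.comp S.adj
  adj_op_smul y a := by
    change T.adj (S.adj (y <• a)) = T.adj (S.adj y) <• a
    rw [S.adj_op_smul, T.adj_op_smul]
  inner_map x y := by
    change inner A (S (T x)) y = inner A x (T.adj (S.adj y))
    rw [S.inner_map, T.inner_map]

/-- The adjoint `T* ∈ L(F, E)` of `T ∈ L(E, F)`. -/
def adjoint [NonUnitalRing A] [StarRing A] [Module ℂ A] [IsInnerModule A E] [IsInnerModule A F]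
    (T : AdjointableMap A E F) : AdjointableMap A F E where
  toLinearMap := T.adj
  map_op_smul := T.adj_op_smul
  adj := T.toLinearMap
  adj_op_smul := T.map_op_smul
  inner_map x y := by
    change inner A (T.adj x) y = inner A x (T y)
    rw [← IsInnerModule.star_inner, ← T.inner_map, IsInnerModule.star_inner]

/-- `T ∈ b(L(E, F))`: the operator seminorms of `T` are bounded uniformly in `p ∈ S(A)`. -/
def IsBounded [NonUnitalRing A] [StarRing A] [Module ℂ A] [TopologicalSpace A]
    (T : AdjointableMap A E F) : Prop :=
  ∃ M : ℝ, ∀ (p : CStarSeminorm A) (x : E), p.onModule (T x) ≤ M * p.onModule x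

/-- `T` is an invertible element of the algebra `b(L(E))`. -/
def IsBoundedInvertible [NonUnitalRing A] [StarRing A] [Module ℂ A] [TopologicalSpace A]
    (T : AdjointableMap A E E) : Prop :=
  T.IsBounded ∧ ∃ R : AdjointableMap A E E, R.IsBounded ∧ ∀ x : E, T (R x) = x ∧ R (T x) = x

/-- `T` is a positive element of the algebra `L(E)`: it has the form `R* ∘ R`. -/
def IsPositive [NonUnitalRing A] [StarRing A] [Module ℂ A] [IsInnerModule A E]
    (T : AdjointableMap A E E) : Prop :=
  ∃ R : AdjointableMap A E E, ∀ x : E, T x = R.adjoint (R x)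

/-- `T = S ^ (-1/2)`: `T` is positive and `T ∘ T` is the inverse of `S`. -/
def IsInvSqrt [NonUnitalRing A] [StarRing A] [Module ℂ A] [IsInnerModule A E]
    (T S : AdjointableMap A E E) : Prop :=
  T.IsPositive ∧ ∀ x : E, T (T (S x)) = x ∧ S (T (T x)) = x

end AdjointableMap

/-! ### The Hilbert modules `A` and `H_A` -/

section Standard

variable (A : Type u) [NonUnitalRing A] [StarRing A]

/-- The inner product `⟨a, b⟩ = a* b` of `A` as a module over itself. -/
scoped instance instInnerSelf : Inner A A := ⟨fun a b => star a * b⟩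

lemma inner_self_def (a b : A) : inner A a b = star a * b := rfl

instance isInnerModule_self [Module ℂ A] [IsScalarTower ℂ A A] [SMulCommClass ℂ A A] :
    IsInnerModule A A where
  add_op_smul x y a := add_mul x y a
  op_smul_add x a b := mul_add x a b
  op_smul_mul x a b := (mul_assoc x a b).symm
  smul_op_smul z x a := smul_mul_assoc z x a
  op_smul_smul z x a := mul_smul_comm z x a
  inner_add_right x y z := mul_add _ y z
  inner_smul_right c x y := mul_smul_comm c _ y
  inner_op_smul_right x y a := (mul_assoc _ y a).symm
  star_inner x y := by simp [inner_self_def]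

variable [Module ℂ A] [UniformSpace A] [ProCStarAlgebra A] [PartialOrder A] [StarOrderedRing A]

instance isPreHilbertModule_self : IsPreHilbertModule A A where
  inner_self_nonneg a := star_mul_self_nonneg a
  inner_self_eq_zero a := by
    refine ⟨fun h => ?_, fun h => by simp [h, inner_self_def]⟩
    by_contra ha
    obtain ⟨p, hp⟩ := (ProCStarAlgebra.withSeminorms (A := A)).separating_of_T1 a ha
    apply hp
    have h1 := p.star_mul_self a
    rw [inner_self_def] at h
    rw [h, map_zero] at h1
    exact mul_self_eq_zero.1 h1.symm

/-- The space `H_A` of sequences `(aₙ)` in `A` such that `∑ aₙ* aₙ` converges in `A`. -/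
def stdModule : Submodule ℂ (ℕ → A) where
  carrier := {a | ∃ s : A, Tendsto (fun n => ∑ k ∈ range n, star (a k) * a k) atTop (𝓝 s)}
  zero_mem' := ⟨0, by simp⟩
  add_mem' := by
    rintro a b ⟨s, hs⟩ ⟨t, ht⟩
    refine exists_tendsto_sum_of_le (d := fun k => (star (a k) * a k + star (a k) * a k) +
      (star (b k) * b k + star (b k) * b k)) (fun k => star_mul_self_nonneg _) (fun k => ?_)
      ⟨(s + s) + (t + t), ?_⟩
    · rw [← sub_nonneg]
      have := star_mul_self_nonneg (a k - b k)
      convert this using 1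
      simp only [Pi.add_apply, star_add, star_sub]
      noncomm_ring
    · simp only [sum_add_distrib]
      exact (hs.add hs).add (ht.add ht)
  smul_mem' := by
    rintro c a ⟨s, hs⟩
    refine ⟨(star c * c) • s, ?_⟩
    have := ((continuous_smul' (A := A) (star c * c)).tendsto s).comp hs
    refine this.congr fun n => ?_
    simp [smul_sum, smul_mul_smul_comm]

/-- The space `H_A` as a type. -/
abbrev HA : Type u := stdModule A

variable {A}

/-- The right action `(aₙ) b = (aₙ b)`. -/
instance : SMul Aᵐᵒᵖ (HA A) where
  smul b a := ⟨fun n => a.1 n * b.unop, by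
    obtain ⟨s, hs⟩ := a.2
    refine ⟨star b.unop * s * b.unop, ?_⟩
    have := ((continuous_mul_right' b.unop).tendsto _).comp
      (((continuous_mul_left' (star b.unop)).tendsto s).comp hs)
    refine this.congr fun n => ?_
    simp [mul_sum, sum_mul, mul_assoc]⟩

lemma HA.op_smul_apply (a : HA A) (b : A) (n : ℕ) : (a <• b).1 n = a.1 n * b := rfl

/-- The inner product `⟨(aₙ), (bₙ)⟩ = ∑ aₙ* bₙ`. -/
instance : Inner A (HA A) where
  inner a b := limUnder atTop fun n => ∑ k ∈ range n, star (a.1 k) * b.1 k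

/-- The series that defines the inner product of `H_A` converges. -/
lemma HA.tendsto_inner (a b : HA A) :
    Tendsto (fun n => ∑ k ∈ range n, star (a.1 k) * b.1 k) atTop (𝓝 (inner A a b)) := by
  refine tendsto_nhds_limUnder ?_
  obtain ⟨s₁, h₁⟩ := (a + b).2
  obtain ⟨s₂, h₂⟩ := (a - b).2
  obtain ⟨s₃, h₃⟩ := (a + Complex.I • b).2
  obtain ⟨s₄, h₄⟩ := (a - Complex.I • b).2
  have hs := fun (c : ℂ) {u : ℕ → A} {s : A} (h : Tendsto u atTop (𝓝 s)) =>
    ((continuous_smul' (A := A) c).tendsto s).comp h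
  have h := ((hs (1 / 4) h₁).add (hs (-1 / 4) h₂)).add
    ((hs (-Complex.I / 4) h₃).add (hs (Complex.I / 4) h₄))
  refine ⟨_, h.congr fun n => ?_⟩
  simp only [Function.comp, smul_sum, ← sum_add_distrib]
  refine sum_congr rfl fun k _ => ?_
  simp only [Submodule.coe_add, Submodule.coe_sub, Submodule.coe_smul, Pi.add_apply, Pi.sub_apply,
    Pi.smul_apply, star_add, star_sub, star_smul, mul_add, add_mul, mul_sub, sub_mul,
    smul_mul_assoc, mul_smul_comm]
  have hI : (star Complex.I : ℂ) = -Complex.I := by simp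
  rw [hI]
  match_scalars <;> ring_nf <;> simp [Complex.I_sq] <;> ring

instance : IsInnerModule A (HA A) where
  add_op_smul x y a := Subtype.ext (funext fun n => add_mul _ _ _)
  op_smul_add x a b := Subtype.ext (funext fun n => mul_add _ _ _)
  op_smul_mul x a b := Subtype.ext (funext fun n => (mul_assoc _ _ _).symm)
  smul_op_smul z x a := Subtype.ext (funext fun n => smul_mul_assoc _ _ _)
  op_smul_smul z x a := Subtype.ext (funext fun n => mul_smul_comm _ _ _)
  inner_add_right x y z := by
    refine tendsto_nhds_unique (HA.tendsto_inner x (y + z)) ?_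
    refine ((HA.tendsto_inner x y).add (HA.tendsto_inner x z)).congr fun n => ?_
    simp [mul_add, sum_add_distrib]
  inner_smul_right c x y := by
    refine tendsto_nhds_unique (HA.tendsto_inner x (c • y)) ?_
    refine (((continuous_smul' (A := A) c).tendsto _).comp (HA.tendsto_inner x y)).congr
      fun n => ?_
    simp [smul_sum, mul_smul_comm]
  inner_op_smul_right x y a := by
    refine tendsto_nhds_unique (HA.tendsto_inner x (y <• a)) ?_
    refine (((continuous_mul_right' a).tendsto _).comp (HA.tendsto_inner x y)).congr fun n => ?_
    simp [sum_mul, HA.op_smul_apply, mul_assoc]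
  star_inner x y := by
    refine tendsto_nhds_unique ?_ (HA.tendsto_inner y x)
    refine (((continuous_star' (A := A)).tendsto _).comp (HA.tendsto_inner x y)).congr fun n => ?_
    simp

end Standard

/-! ### Multipliers and frames -/

section Frames

variable {A : Type u} {E : Type v} [NonUnitalRing A] [StarRing A] [Module ℂ A]
  [UniformSpace A] [ProCStarAlgebra A] [PartialOrder A] [StarOrderedRing A]
  [AddCommGroup E] [Module ℂ E] [SMul Aᵐᵒᵖ E] [Inner A E]

variable (A E) in
/-- The multiplier module `M(E) = L(A, E)`. -/
abbrev Multiplier : Type (max u v) := AdjointableMap A A E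

variable (A E) in
/-- `E` is countably generated in `M(E)`: for some sequence `(gₙ)` in `M(E)`, the closed submodule
generated by the elements `gₙ · a = gₙ(a)` is all of `E`. -/
def IsCountablyGeneratedInMultipliers [TopologicalSpace E] : Prop :=
  ∃ g : ℕ → Multiplier A E, ∀ N : Submodule ℂ E, (∀ x ∈ N, ∀ a : A, x <• a ∈ N) →
    IsClosed (N : Set E) → (∀ (n : ℕ) (a : A), g n a ∈ N) → N = ⊤

/-- The inner product `⟨h, x⟩ = h*(x)` of a multiplier `h ∈ M(E)` with `x ∈ E`, an element
of `A`. -/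
def Multiplier.innerRight (h : Multiplier A E) (x : E) : A := h.adj x

/-- The inner product `⟨x, h⟩ = ⟨h, x⟩*` of `x ∈ E` with a multiplier `h ∈ M(E)`. -/
def Multiplier.innerLeft (x : E) (h : Multiplier A E) : A := star (h.innerRight x)

/-- `(hₙ)` is a standard frame of multipliers in `E` with bounds `C` and `D`: for all `x`, the
series `∑ ⟨x, hₙ⟩⟨hₙ, x⟩` converges in `A` and `C⟨x, x⟩ ≤ ∑ ⟨x, hₙ⟩⟨hₙ, x⟩ ≤ D⟨x, x⟩`. -/
def IsStandardFrameWith (C D : ℝ) (h : ℕ → Multiplier A E) : Prop :=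
  ∀ x : E, ∃ s : A,
    Tendsto (fun n => ∑ k ∈ range n, Multiplier.innerLeft x (h k) * (h k).innerRight x)
      atTop (𝓝 s) ∧
    (C : ℂ) • inner A x x ≤ s ∧ s ≤ (D : ℂ) • inner A x x

/-- A standard frame of multipliers. -/
def IsStandardFrame (h : ℕ → Multiplier A E) : Prop :=
  ∃ C D : ℝ, 0 < C ∧ 0 < D ∧ IsStandardFrameWith C D h

/-- A standard normalised frame of multipliers. -/
def IsStandardNormalisedFrame (h : ℕ → Multiplier A E) : Prop :=
  IsStandardFrameWith 1 1 h

/-- The frame transform `θ : E → H_A`, `θ(x) = (⟨hₙ, x⟩)ₙ`, of a standard frame of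
multipliers. -/
def frameTransform (h : ℕ → Multiplier A E) (hh : IsStandardFrame h) (x : E) : HA A :=
  ⟨fun n => (h n).innerRight x, by
    obtain ⟨C, D, -, -, hf⟩ := hh
    obtain ⟨s, hs, -⟩ := hf x
    exact ⟨s, hs⟩⟩

end Frames

end ProCStar

end

open ProCStar

/-! Let `S = θ*θ` be the frame operator. Since `⟨x, Sx⟩ = ⟨θx, θx⟩ = ∑ ⟨x, hₙ⟩⟨hₙ, x⟩`, the frame
inequalities say that `C ≤ S ≤ D` as forms. If `T` is self-adjoint, the coefficients of `T ∘ hₙ` at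
`x` are those of `hₙ` at `Tx`, so their series sums to `⟨x, TSTx⟩`. Thus `TST = 1` makes the new
frame normalised, and `T = S^(-1/2)` is the natural choice. The work lies in constructing `θ*` and
in finding an algebra where this root exists.

The adjoint of `θ` is the synthesis operator `(aₙ) ↦ ∑ hₙ(aₙ)`. The series converges by
`IsStandardFrameWith.onModule_sum_sq_le`, which combines the Cauchy-Schwarz inequality with the
upper frame bound.

The algebra is `b(L(E))`, normed by the best constant valid for all `p ∈ S(A)` at once. It is a
C*-algebra (`BoundedOp`), so the continuous functional calculus applies. Estimates are made for one
seminorm at a time, where `A` can be represented in a C*-algebra; their constants do not depend on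
`p`.

Forms are turned into norms by `AdjointableMap.onModule_apply_le_of_nonneg`: a positive map is
bounded by its quadratic form. Applied to `1 - D⁻¹S` it gives `‖1 - D⁻¹S‖ < 1`, which makes `S` both
invertible and positive in the C*-algebra; then `S^(-1/2)` is the square root of `S⁻¹`.

For the converse, the coefficients of `T ∘ hₙ` at `y = (T*)⁻¹x` are those of `hₙ` at `x`. Their
series therefore sums to `⟨y, y⟩`, and `BoundedOp.inner_apply_self_le` compares this with `⟨x, x⟩`
from both sides. -/

noncomputable section

set_option linter.unusedSectionVars false

namespace ProCStar

universe u v w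

/-! ### Sesquilinearity of the inner product. -/

section InnerModule

variable {A : Type u} {E : Type v} [NonUnitalRing A] [StarRing A] [Module ℂ A]
  [AddCommGroup E] [Module ℂ E] [SMul Aᵐᵒᵖ E] [Inner A E] [IsInnerModule A E]

lemma inner_add_right' (x y z : E) : inner A x (y + z) = inner A x y + inner A x z :=
  IsInnerModule.inner_add_right x y z

lemma inner_smul_right' (c : ℂ) (x y : E) : inner A x (c • y) = c • inner A x y :=
  IsInnerModule.inner_smul_right c x y

lemma inner_op_smul_right' (x y : E) (a : A) : inner A x (y <• a) = inner A x y * a :=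
  IsInnerModule.inner_op_smul_right x y a

lemma star_inner' (x y : E) : star (inner A x y) = inner A y x := IsInnerModule.star_inner x y

lemma inner_sub_right' (x y z : E) : inner A x (y - z) = inner A x y - inner A x z := by
  rw [sub_eq_add_neg, inner_add_right', ← neg_one_smul ℂ z, inner_smul_right', neg_one_smul,
    sub_eq_add_neg]

lemma inner_zero_right' (x : E) : inner A x (0 : E) = 0 := by
  simpa using inner_sub_right' (A := A) x 0 0

lemma inner_add_left' (x y z : E) : inner A (x + y) z = inner A x z + inner A y z := by
  rw [← star_inner', inner_add_right', star_add, star_inner', star_inner']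

lemma inner_sub_left' (x y z : E) : inner A (x - y) z = inner A x z - inner A y z := by
  rw [← star_inner', inner_sub_right', star_sub, star_inner', star_inner']

lemma inner_zero_left' (x : E) : inner A (0 : E) x = 0 := by
  rw [← star_inner', inner_zero_right', star_zero]

lemma inner_smul_left' [StarModule ℂ A] (c : ℂ) (x y : E) :
    inner A (c • x) y = star c • inner A x y := by
  rw [← star_inner', inner_smul_right', star_smul, star_inner']

lemma inner_op_smul_left' (x y : E) (a : A) : inner A (x <• a) y = star a * inner A x y := by
  rw [← star_inner', inner_op_smul_right', star_mul, star_inner']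

lemma inner_sum_left' {ι : Type*} (F : Finset ι) (x : ι → E) (y : E) :
    inner A (∑ i ∈ F, x i) y = ∑ i ∈ F, inner A (x i) y := by
  classical
  induction F using Finset.induction_on with
  | empty => simp [inner_zero_left']
  | insert i F hi ih => rw [sum_insert hi, sum_insert hi, inner_add_left', ih]

lemma inner_sum_right' {ι : Type*} (F : Finset ι) (y : E) (x : ι → E) :
    inner A y (∑ i ∈ F, x i) = ∑ i ∈ F, inner A y (x i) := by
  rw [← star_inner', inner_sum_left', star_sum]
  simp only [star_inner']

end InnerModule

/-! ### Formal adjoints: linearity for free. -/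

section PreHilbert

variable {A : Type u} {E : Type v} {F : Type w} [NonUnitalRing A] [StarRing A] [Module ℂ A]
  [PartialOrder A] [AddCommGroup E] [Module ℂ E] [SMul Aᵐᵒᵖ E] [Inner A E] [IsPreHilbertModule A E]
  [AddCommGroup F] [Module ℂ F] [SMul Aᵐᵒᵖ F] [Inner A F] [IsInnerModule A F]

variable (A) in
lemma ext_inner_left' {x y : E} (h : ∀ z : E, inner A z x = inner A z y) : x = y := by
  rw [← sub_eq_zero, ← IsPreHilbertModule.inner_self_eq_zero (A := A), inner_sub_right', h,
    sub_self]

/-- A map that is a formal adjoint of some map out of a pre-Hilbert module is linear. -/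
def linearMapOfInner (f : F → E) (g : E → F) (h : ∀ x y, inner A (g x) y = inner A x (f y)) :
    F →ₗ[ℂ] E where
  toFun := f
  map_add' y z := ext_inner_left' A fun x => by
    rw [← h, inner_add_right', inner_add_right', h, h]
  map_smul' c y := ext_inner_left' A fun x => by
    rw [RingHom.id_apply, ← h, inner_smul_right', inner_smul_right', h]

lemma map_op_smul_of_inner (f : F → E) (g : E → F)
    (h : ∀ x y, inner A (g x) y = inner A x (f y)) (y : F) (a : A) : f (y <• a) = f y <• a :=
  ext_inner_left' A fun x => by
    rw [← h, inner_op_smul_right', inner_op_smul_right', h]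

/-- The formal adjointness relation is symmetric. -/
lemma inner_swap {f : F → E} {g : E → F} (h : ∀ x y, inner A (g x) y = inner A x (f y)) (x : F)
    (y : E) : inner A (f x) y = inner A x (g y) := by
  rw [← star_inner', ← h, star_inner']

end PreHilbert

section OfInner

variable {A : Type u} {E : Type v} {F : Type w} [NonUnitalRing A] [StarRing A] [Module ℂ A]
  [PartialOrder A] [AddCommGroup E] [Module ℂ E] [SMul Aᵐᵒᵖ E] [Inner A E] [IsPreHilbertModule A E]
  [AddCommGroup F] [Module ℂ F] [SMul Aᵐᵒᵖ F] [Inner A F] [IsPreHilbertModule A F]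

/-- Maps between pre-Hilbert modules that are formally adjoint are adjointable. -/
def AdjointableMap.ofInner (f : E → F) (g : F → E)
    (h : ∀ x y, inner A (f x) y = inner A x (g y)) : AdjointableMap A E F where
  toLinearMap := linearMapOfInner f g (inner_swap h)
  map_op_smul := map_op_smul_of_inner f g (inner_swap h)
  adj := linearMapOfInner g f h
  adj_op_smul := map_op_smul_of_inner g f h
  inner_map := h

end OfInner

/-! ### Real scalars and the order of `A`. -/

section Order

variable {A : Type u} [NonUnitalRing A] [StarRing A] [Module ℂ A] [IsScalarTower ℂ A A]
  [SMulCommClass ℂ A A] [StarModule ℂ A] [PartialOrder A] [StarOrderedRing A]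

/-- Positive elements are generated additively by the `s* s`, and `c` is absorbed by replacing `s`
with `√c s`. -/
lemma ofReal_smul_nonneg {c : ℝ} (hc : 0 ≤ c) {a : A} (ha : 0 ≤ a) : 0 ≤ (c : ℂ) • a := by
  rw [StarOrderedRing.nonneg_iff] at ha
  induction ha using AddSubmonoid.closure_induction with
  | mem x hx =>
    obtain ⟨s, rfl⟩ := hx
    refine (star_mul_self_nonneg ((√c : ℂ) • s)).trans_eq ?_
    have h : star (√c : ℂ) = √c := Complex.conj_ofReal _
    rw [star_smul, smul_mul_smul_comm, h, ← Complex.ofReal_mul, Real.mul_self_sqrt hc]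
  | zero => simp
  | add x y _ _ hx hy => rw [smul_add]; exact add_nonneg hx hy

lemma ofReal_smul_le_smul {c : ℝ} (hc : 0 ≤ c) {a b : A} (h : a ≤ b) :
    (c : ℂ) • a ≤ (c : ℂ) • b := by
  rw [← sub_nonneg, ← smul_sub]
  exact ofReal_smul_nonneg hc (sub_nonneg.2 h)

lemma ofReal_smul_le_smul_right {c d : ℝ} (h : c ≤ d) {a : A} (ha : 0 ≤ a) :
    (c : ℂ) • a ≤ (d : ℂ) • a := by
  rw [← sub_nonneg, ← sub_smul, ← Complex.ofReal_sub]
  exact ofReal_smul_nonneg (sub_nonneg.2 h) ha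

end Order

/-! ### Cauchy-Schwarz inequalities, one C*-seminorm at a time. -/

section CauchySchwarz

variable {A : Type u} [NonUnitalRing A] [StarRing A] [Module ℂ A] [UniformSpace A]
  [ProCStarAlgebra A] [PartialOrder A] [StarOrderedRing A]

/-- The Cauchy-Schwarz inequality from the nonnegativity of the quadratic function
`t ↦ u - 2 t b* b + t² b* v b`. -/
lemma CStarSeminorm.sq_le_mul_of_nonneg (p : CStarSeminorm A) {u v b : A} (hv : 0 ≤ v)
    (h : ∀ t : ℝ, 0 ≤ u - (t : ℂ) • (star b * b) - (t : ℂ) • (star b * b)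
      + ((t : ℂ) ^ 2) • (star b * v * b)) :
    p.toSeminorm b ^ 2 ≤ p.toSeminorm u * p.toSeminorm v := by
  obtain ⟨C, _, φ, hφ⟩ := p.exists_rep
  let _ : PartialOrder C := CStarAlgebra.spectralOrder C
  have _ : StarOrderedRing C := CStarAlgebra.spectralOrderedRing C
  have hv' : 0 ≤ φ v := by simpa using OrderHomClass.mono φ hv
  simp only [← hφ]
  -- In the C*-algebra `b* v b ≤ ‖v‖ b* b`, so the quadratic function leaves only multiples of `b*
  -- b` to compare with `u`.
  have key : ∀ t : ℝ, 0 ≤ 2 * t - t ^ 2 * ‖φ v‖ → (2 * t - t ^ 2 * ‖φ v‖) * ‖φ b‖ ^ 2 ≤ ‖φ u‖ := by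
    intro t ht
    have h1 : 0 ≤ φ (u - (t : ℂ) • (star b * b) - (t : ℂ) • (star b * b)
      + ((t : ℂ) ^ 2) • (star b * v * b)) := by simpa using OrderHomClass.mono φ (h t)
    have h2 : star (φ b) * φ v * φ b ≤ ‖φ v‖ • (star (φ b) * φ b) :=
      CStarAlgebra.star_left_conjugate_le_norm_smul (IsSelfAdjoint.of_nonneg hv')
    have h3 : (t ^ 2) • (star (φ b) * φ v * φ b) ≤ (t ^ 2) • (‖φ v‖ • (star (φ b) * φ b)) :=
      smul_le_smul_of_nonneg_left h2 (sq_nonneg t)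
    have hc : ∀ (s : ℝ) (z : C), (s : ℂ) • z = s • z := fun s z => Complex.coe_smul s z
    simp only [map_add, map_sub, map_smul, map_mul, map_star, ← Complex.ofReal_pow, hc] at h1
    have h4 : (2 * t - t ^ 2 * ‖φ v‖) • (star (φ b) * φ b) ≤ φ u := by
      rw [← sub_nonneg]
      refine (h1.trans (add_le_add_right h3 _)).trans_eq ?_
      module
    have h5 := CStarAlgebra.norm_le_norm_of_nonneg_of_le
      (smul_nonneg ht (star_mul_self_nonneg (φ b))) h4
    rwa [norm_smul, CStarRing.norm_star_mul_self, Real.norm_of_nonneg ht, ← pow_two] at h5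
  rcases (norm_nonneg (φ v)).eq_or_lt with h0 | h0
  · rw [← h0, mul_zero]
    by_contra! hb
    -- With `φ v = 0` the bound is linear in `t`, so a large `t` contradicts it.
    have := key ((‖φ u‖ + 1) / ‖φ b‖ ^ 2) (by rw [← h0]; simp; positivity)
    rw [← h0, mul_zero, sub_zero, mul_assoc, div_mul_cancel₀ _ hb.ne'] at this
    linarith [norm_nonneg (φ u)]
  -- The value `t = ‖φ v‖⁻¹` maximises `2t - t²‖φ v‖`.
  · have e : 2 * ‖φ v‖⁻¹ - ‖φ v‖⁻¹ ^ 2 * ‖φ v‖ = ‖φ v‖⁻¹ := by field_simp; ring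
    have := key ‖φ v‖⁻¹ (by rw [e]; positivity)
    rwa [e, inv_mul_le_iff₀ h0, mul_comm] at this

/-- The Cauchy-Schwarz inequality for finite sequences in `A`. -/
lemma CStarSeminorm.sum_sq_le (p : CStarSeminorm A) {ι : Type*} (F : Finset ι) (a b : ι → A) :
    p.toSeminorm (∑ k ∈ F, star (a k) * b k) ^ 2 ≤
      p.toSeminorm (∑ k ∈ F, star (b k) * b k) * p.toSeminorm (∑ k ∈ F, star (a k) * a k) := by
  refine p.sq_le_mul_of_nonneg (sum_nonneg fun k _ => star_mul_self_nonneg _) fun t => ?_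
  set c := ∑ k ∈ F, star (a k) * b k with hc
  have e1 : star c * c = ∑ k ∈ F, star (b k) * a k * c := by
    rw [← sum_mul, hc, star_sum]; simp
  have e2 : star c * c = ∑ k ∈ F, star c * (star (a k) * b k) := by
    rw [← mul_sum]
  -- Expanding these squares gives the required quadratic function, with `c` in the role of `b`.
  have h0 : 0 ≤ ∑ k ∈ F, star (b k - (t : ℂ) • (a k * c)) * (b k - (t : ℂ) • (a k * c)) :=
    sum_nonneg fun k _ => star_mul_self_nonneg _
  refine h0.trans_eq ?_
  have e3 : ∀ k, star (b k - (t : ℂ) • (a k * c)) * (b k - (t : ℂ) • (a k * c)) =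
      star (b k) * b k - (t : ℂ) • (star (b k) * a k * c) - (t : ℂ) • (star c * (star (a k) * b k))
        + ((t : ℂ) ^ 2) • (star c * (star (a k) * a k) * c) := by
    intro k
    have ht : star (t : ℂ) = t := Complex.conj_ofReal t
    simp only [star_sub, star_smul, star_mul, ht, mul_sub, sub_mul, smul_mul_assoc, mul_smul_comm,
      mul_assoc]
    module
  simp only [e3, sum_add_distrib, sum_sub_distrib, ← smul_sum]
  rw [← e1, ← e2, ← sum_mul, ← mul_sum]

end CauchySchwarz

/-! ### The seminorms on a pre-Hilbert module. -/

section OnModule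

variable {A : Type u} {E : Type v} [NonUnitalRing A] [StarRing A] [Module ℂ A]
  [TopologicalSpace A] [Inner A E] (p : CStarSeminorm A)

lemma CStarSeminorm.onModule_sq (x : E) : p.onModule x ^ 2 = p.toSeminorm (inner A x x) :=
  Real.sq_sqrt (apply_nonneg _ _)

lemma CStarSeminorm.onModule_nonneg (x : E) : 0 ≤ p.onModule x := Real.sqrt_nonneg _

end OnModule

section ModuleSeminorm

variable {A : Type u} {E : Type v} {F : Type w} [NonUnitalRing A] [StarRing A] [Module ℂ A]
  [UniformSpace A] [ProCStarAlgebra A] [PartialOrder A] [StarOrderedRing A]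
  [AddCommGroup E] [Module ℂ E] [SMul Aᵐᵒᵖ E] [Inner A E] [IsPreHilbertModule A E]
  [AddCommGroup F] [Module ℂ F] [SMul Aᵐᵒᵖ F] [Inner A F] [IsPreHilbertModule A F]

namespace AdjointableMap

variable (A E) in
/-- The identity map. -/
protected def id : AdjointableMap A E E where
  toLinearMap := LinearMap.id
  map_op_smul _ _ := rfl
  adj := LinearMap.id
  adj_op_smul _ _ := rfl
  inner_map _ _ := rfl

/-- The Cauchy-Schwarz inequality for the form `⟨x, K y⟩` of a positive map `K`. -/
lemma sq_inner_le_of_nonneg (p : CStarSeminorm A) (K : AdjointableMap A E E)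
    (hK : ∀ x y : E, inner A (K x) y = inner A x (K y)) (hpos : ∀ x : E, 0 ≤ inner A x (K x))
    (x y : E) : p.toSeminorm (inner A y (K x)) ^ 2 ≤
      p.toSeminorm (inner A x (K x)) * p.toSeminorm (inner A y (K y)) := by
  refine p.sq_le_mul_of_nonneg (hpos y) fun t => ?_
  set b := inner A y (K x) with hb
  have hb' : star b = inner A x (K y) := by rw [hb, star_inner', hK]
  -- The quadratic function is the form of `K` at `x - t y b`.
  refine (hpos (x - (t : ℂ) • (y <• b))).trans_eq ?_
  have e : K (x - (t : ℂ) • (y <• b)) = K x - (t : ℂ) • (K y <• b) := by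
    rw [← K.map_op_smul]; exact (map_sub K.toLinearMap _ _).trans (by rw [map_smul]; rfl)
  have ht : star (t : ℂ) = t := Complex.conj_ofReal t
  rw [e]
  simp only [inner_sub_left', inner_sub_right', inner_smul_left', inner_smul_right',
    inner_op_smul_left', inner_op_smul_right', ← hb, ← hb', ht, sub_mul, smul_mul_assoc, mul_assoc]
  module

end AdjointableMap

namespace CStarSeminorm

variable (p : CStarSeminorm A)

/-- The Cauchy-Schwarz inequality. -/
lemma apply_inner_le (x y : E) : p.toSeminorm (inner A x y) ≤ p.onModule x * p.onModule y := by
  refine le_of_sq_le_sq ?_ (mul_nonneg (p.onModule_nonneg x) (p.onModule_nonneg y))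
  rw [mul_pow, onModule_sq, onModule_sq, mul_comm]
  exact AdjointableMap.sq_inner_le_of_nonneg p (AdjointableMap.id A E) (fun _ _ => rfl)
    (fun x => IsPreHilbertModule.inner_self_nonneg x) y x

variable (E) in
/-- `p.onModule` as a seminorm. -/
def moduleSeminorm : Seminorm ℂ E :=
  Seminorm.of p.onModule
    (fun x y => by
      refine le_of_sq_le_sq ?_ (add_nonneg (p.onModule_nonneg x) (p.onModule_nonneg y))
      rw [onModule_sq, inner_add_left', inner_add_right', inner_add_right']
      have h1 := map_add_le_add p.toSeminorm (inner A x x + inner A x y)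
        (inner A y x + inner A y y)
      have h2 := map_add_le_add p.toSeminorm (inner A x x) (inner A x y)
      have h3 := map_add_le_add p.toSeminorm (inner A y x) (inner A y y)
      have h4 := p.apply_inner_le x y
      have h5 := p.apply_inner_le y x
      have h6 := p.onModule_sq x
      have h7 := p.onModule_sq y
      nlinarith)
    (fun c x => by
      rw [onModule, inner_smul_left', inner_smul_right', smul_smul, map_smul_eq_mul, onModule]
      rw [Real.sqrt_mul (norm_nonneg _), norm_mul, norm_star, Real.sqrt_mul_self (norm_nonneg _)])

lemma moduleSeminorm_apply (x : E) : p.moduleSeminorm E x = p.onModule x := rfl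

lemma onModule_zero : p.onModule (0 : E) = 0 := map_zero (p.moduleSeminorm E)

lemma onModule_sub_rev (x y : E) : p.onModule (x - y) = p.onModule (y - x) :=
  map_sub_rev (p.moduleSeminorm E) x y

lemma onModule_add_le (x y : E) : p.onModule (x + y) ≤ p.onModule x + p.onModule y :=
  map_add_le_add (p.moduleSeminorm E) x y

lemma onModule_smul (c : ℂ) (x : E) : p.onModule (c • x) = ‖c‖ * p.onModule x :=
  map_smul_eq_mul (p.moduleSeminorm E) c x

end CStarSeminorm

lemma eq_zero_of_forall_onModule {x : E} (h : ∀ p : CStarSeminorm A, p.onModule x = 0) :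
    x = 0 := by
  rw [← IsPreHilbertModule.inner_self_eq_zero (A := A)]
  by_contra hx
  obtain ⟨p, hp⟩ := (ProCStarAlgebra.withSeminorms (A := A)).separating_of_T1 _ hx
  exact hp (by rw [← p.onModule_sq, h p, sq, mul_zero])

end ModuleSeminorm

/-! ### Convergence in a Hilbert module through its seminorms. -/

section HilbertTopology

variable (A : Type u) {E : Type v} [NonUnitalRing A] [StarRing A] [Module ℂ A]
  [UniformSpace A] [ProCStarAlgebra A] [PartialOrder A] [StarOrderedRing A]
  [AddCommGroup E] [Module ℂ E] [SMul Aᵐᵒᵖ E] [Inner A E] [UniformSpace E] [IsHilbertModule A E]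

lemma tendsto_iff_onModule {ι : Type*} {l : Filter ι} (f : ι → E) (x : E) :
    Tendsto f l (𝓝 x) ↔
      ∀ p : CStarSeminorm A, Tendsto (fun i => p.onModule (f i - x)) l (𝓝 0) := by
  rw [nhds_eq_comap_uniformity, IsHilbertModule.uniformity_eq (A := A), Filter.comap_iInf,
    tendsto_iInf]
  refine forall_congr' fun p => ?_
  rw [Filter.comap_comap, tendsto_comap_iff]
  exact tendsto_congr fun i => p.onModule_sub_rev _ _

/-- A sequence in a Hilbert module converges if its differences are bounded by null families. -/
lemma exists_tendsto_of_onModule_le (f : ℕ → E)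
    (h : ∀ p : CStarSeminorm A, ∃ g : ℕ × ℕ → ℝ, Tendsto g atTop (𝓝 0) ∧
      ∀ i, p.onModule (f i.1 - f i.2) ≤ g i) : ∃ x, Tendsto f atTop (𝓝 x) := by
  have := IsHilbertModule.complete (A := A) (E := E)
  refine cauchySeq_tendsto_of_complete ?_
  rw [cauchySeq_iff_tendsto, IsHilbertModule.uniformity_eq (A := A), tendsto_iInf]
  refine fun p => tendsto_comap_iff.2 ?_
  obtain ⟨g, hg, hfg⟩ := h p
  exact squeeze_zero (fun _ => p.onModule_nonneg _) hfg hg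

variable {A}

lemma tendsto_onModule (p : CStarSeminorm A) {ι : Type*} {l : Filter ι} {f : ι → E} {x : E}
    (h : Tendsto f l (𝓝 x)) : Tendsto (fun i => p.onModule (f i)) l (𝓝 (p.onModule x)) := by
  rw [tendsto_iff_dist_tendsto_zero]
  refine squeeze_zero (fun _ => dist_nonneg) (fun i => ?_) ((tendsto_iff_onModule A f x).1 h p)
  exact abs_sub_map_le_sub (p.moduleSeminorm E) _ _

lemma tendsto_inner_right {ι : Type*} {l : Filter ι} {f : ι → E} {x : E} (y : E)
    (h : Tendsto f l (𝓝 x)) : Tendsto (fun i => inner A y (f i)) l (𝓝 (inner A y x)) := by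
  refine (tendsto_iff _ _).2 fun p ε hε => ?_
  have h1 : Tendsto (fun i => p.onModule y * p.onModule (f i - x)) l (𝓝 0) := by
    simpa using ((tendsto_iff_onModule A f x).1 h p).const_mul (p.onModule y)
  filter_upwards [h1.eventually_lt_const hε] with i hi
  rw [← inner_sub_right']
  exact (p.apply_inner_le _ _).trans_lt hi

lemma tendsto_inner_left {ι : Type*} {l : Filter ι} {f : ι → E} {x : E} (y : E)
    (h : Tendsto f l (𝓝 x)) : Tendsto (fun i => inner A (f i) y) l (𝓝 (inner A x y)) := by
  simpa only [Function.comp_def, star_inner'] using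
    ((continuous_star' (A := A)).tendsto _).comp (tendsto_inner_right y h)

end HilbertTopology

/-! ### The normed *-algebra `b(L(E))`. -/

section BoundedOperators

variable (A : Type u) (E : Type v) [NonUnitalRing A] [StarRing A] [Module ℂ A]
  [UniformSpace A] [ProCStarAlgebra A] [PartialOrder A] [StarOrderedRing A]
  [AddCommGroup E] [Module ℂ E] [SMul Aᵐᵒᵖ E] [Inner A E] [IsPreHilbertModule A E]

/-- The algebra `b(L(E))`, as an algebra of linear maps. -/
def boundedSubalgebra : Subalgebra ℂ (Module.End ℂ E) where
  -- Inside `Module.End ℂ E` the algebra axioms are inherited; the adjoint is unique, so its mere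
  -- existence suffices.
  carrier := {f | ∃ T : AdjointableMap A E E, T.toLinearMap = f ∧ T.IsBounded}
  mul_mem' := by
    rintro _ _ ⟨S, rfl, M, hM⟩ ⟨T, rfl, N, hN⟩
    -- `IsBounded` does not ask for a nonnegative constant, but chaining the two bounds does.
    refine ⟨S.comp T, rfl, max M 0 * N, fun p x => ?_⟩
    have h1 : p.onModule (S (T x)) ≤ max M 0 * p.onModule (T x) :=
      (hM p (T x)).trans (mul_le_mul_of_nonneg_right (le_max_left _ _) (p.onModule_nonneg _))
    rw [mul_assoc]
    exact h1.trans (mul_le_mul_of_nonneg_left (hN p x) (le_max_right _ _))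
  add_mem' := by
    rintro _ _ ⟨S, rfl, M, hM⟩ ⟨T, rfl, N, hN⟩
    refine ⟨.ofInner (S.toLinearMap + T.toLinearMap) (S.adj + T.adj) fun x y => ?_, rfl, M + N,
      fun p x => ?_⟩
    · rw [Pi.add_apply, Pi.add_apply, inner_add_left', inner_add_right', ← S.inner_map,
        ← T.inner_map]; rfl
    · rw [add_mul]
      exact (p.onModule_add_le _ _).trans (add_le_add (hM p x) (hN p x))
  algebraMap_mem' c := by
    refine ⟨.ofInner (fun x => c • x) (fun x => star c • x) fun x y => ?_, rfl, ‖c‖, fun p x => ?_⟩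
    · rw [inner_smul_left', inner_smul_right']
    · exact (p.onModule_smul c x).le

/-- The algebra `b(L(E))`, as a type. -/
def BoundedOp : Type v := boundedSubalgebra A E

namespace BoundedOp

instance : Ring (BoundedOp A E) := inferInstanceAs (Ring (boundedSubalgebra A E))
instance : Algebra ℂ (BoundedOp A E) := inferInstanceAs (Algebra ℂ (boundedSubalgebra A E))

variable {A E}

instance : CoeFun (BoundedOp A E) fun _ => E → E := ⟨fun T => T.1⟩

lemma ext {S T : BoundedOp A E} (h : ∀ x, S x = T x) : S = T :=
  Subtype.ext (LinearMap.ext h)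

lemma zero_apply (x : E) : (0 : BoundedOp A E) x = 0 := rfl
lemma one_apply (x : E) : (1 : BoundedOp A E) x = x := rfl
lemma add_apply (S T : BoundedOp A E) (x : E) : (S + T) x = S x + T x := rfl
lemma sub_apply (S T : BoundedOp A E) (x : E) : (S - T) x = S x - T x := rfl
lemma neg_apply (T : BoundedOp A E) (x : E) : (-T) x = -T x := rfl
lemma mul_apply (S T : BoundedOp A E) (x : E) : (S * T) x = S (T x) := rfl
lemma smul_apply (c : ℂ) (T : BoundedOp A E) (x : E) : (c • T) x = c • T x := rfl

/-- The adjointable map that underlies an element of `b(L(E))`. -/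
def toMap (T : BoundedOp A E) : AdjointableMap A E E := T.2.choose

lemma toMap_apply (T : BoundedOp A E) (x : E) : T.toMap x = T x :=
  congrArg (fun f : Module.End ℂ E => f x) T.2.choose_spec.1

lemma isBounded_toMap (T : BoundedOp A E) : T.toMap.IsBounded := T.2.choose_spec.2

end BoundedOp

variable {A E}

/-- The seminorm of a positive adjointable map is bounded by that of its quadratic form. -/
lemma AdjointableMap.onModule_apply_le_of_nonneg (K : AdjointableMap A E E)
    (hK : ∀ x y : E, inner A (K x) y = inner A x (K y)) (hpos : ∀ x : E, 0 ≤ inner A x (K x))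
    {r : ℝ} (hr : 0 ≤ r) (p : CStarSeminorm A)
    (hle : ∀ x : E, p.toSeminorm (inner A x (K x)) ≤ r * p.onModule x ^ 2) (x : E) :
    p.onModule (K x) ≤ r * p.onModule x := by
  -- Taking `y = Kx` puts the fourth power of the seminorm of `Kx` on the left; the bound on the
  -- form at `Kx` returns its square, which cancels.
  have hcs := AdjointableMap.sq_inner_le_of_nonneg p K hK hpos x (K x)
  rw [← p.onModule_sq] at hcs
  rcases (p.onModule_nonneg (K x)).eq_or_lt with h0 | h0
  · rw [← h0]; exact mul_nonneg hr (p.onModule_nonneg x)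
  refine le_of_sq_le_sq (le_of_mul_le_mul_right ?_ (pow_pos h0 2))
    (mul_nonneg hr (p.onModule_nonneg x))
  rw [← sq]
  refine hcs.trans ((mul_le_mul (hle x) (hle (K x)) (apply_nonneg _ _)
    (mul_nonneg hr (sq_nonneg _))).trans_eq ?_)
  ring

/-- A bounded adjointable map as an element of `b(L(E))`. -/
def AdjointableMap.toBoundedOp (T : AdjointableMap A E E) (hT : T.IsBounded) : BoundedOp A E :=
  ⟨T.toLinearMap, T, rfl, hT⟩

/-- From `⟨T*x, T*x⟩ = ⟨x, TT*x⟩` and Cauchy-Schwarz, one factor of the seminorm of `T*x` cancels,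
so the same constant `M` works. -/
lemma AdjointableMap.isBounded_adjoint {T : AdjointableMap A E E} (hT : T.IsBounded) :
    T.adjoint.IsBounded := by
  obtain ⟨M, hM⟩ := hT
  refine ⟨M, fun p x => ?_⟩
  rcases (p.onModule_nonneg (T.adjoint x)).eq_or_lt with h | h
  · have h1 := hM p x
    rw [← h]
    exact (p.onModule_nonneg _).trans h1
  · refine le_of_mul_le_mul_right ?_ h
    have h1 := p.apply_inner_le x (T (T.adjoint x))
    have h2 : inner A (T.adjoint x) (T.adjoint x) = inner A x (T (T.adjoint x)) :=
      T.adjoint.inner_map _ _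
    rw [← h2, ← p.onModule_sq] at h1
    nlinarith [hM p (T.adjoint x), p.onModule_nonneg x]

namespace BoundedOp

instance : Star (BoundedOp A E) :=
  ⟨fun T => T.toMap.adjoint.toBoundedOp (AdjointableMap.isBounded_adjoint T.isBounded_toMap)⟩

lemma inner_apply_left (T : BoundedOp A E) (x y : E) : inner A (T x) y = inner A x (star T y) := by
  rw [← toMap_apply]
  exact T.toMap.inner_map x y

/-- Uniqueness of adjoints; the laws of the involution all reduce to it. -/
lemma eq_star_of_inner {S T : BoundedOp A E} (h : ∀ x y, inner A (T x) y = inner A x (S y)) :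
    S = star T :=
  ext fun y => ext_inner_left' A fun x => by rw [← h, inner_apply_left]

instance : StarRing (BoundedOp A E) where
  star_involutive T := (eq_star_of_inner fun x y => by
    rw [← star_inner', ← inner_apply_left, star_inner']).symm
  star_mul S T := (eq_star_of_inner fun x y => by
    rw [mul_apply, mul_apply, inner_apply_left, inner_apply_left]).symm
  star_add S T := (eq_star_of_inner fun x y => by
    rw [add_apply, add_apply, inner_add_left', inner_add_right', inner_apply_left,
      inner_apply_left]).symm

instance : StarModule ℂ (BoundedOp A E) where
  star_smul c T := (eq_star_of_inner fun x y => by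
    rw [smul_apply, smul_apply, inner_smul_left', inner_smul_right', inner_apply_left]).symm

/-- The operator norm of `b(L(E))`. -/
def opNorm (T : BoundedOp A E) : ℝ :=
  sInf {M | 0 ≤ M ∧ ∀ (p : CStarSeminorm A) (x : E), p.onModule (T x) ≤ M * p.onModule x}

lemma opNorm_nonneg (T : BoundedOp A E) : 0 ≤ T.opNorm := Real.sInf_nonneg fun _ h => h.1

lemma opNorm_le {T : BoundedOp A E} {M : ℝ} (hM : 0 ≤ M)
    (h : ∀ (p : CStarSeminorm A) (x : E), p.onModule (T x) ≤ M * p.onModule x) : T.opNorm ≤ M :=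
  csInf_le ⟨0, fun _ h => h.1⟩ ⟨hM, h⟩

/-- The infimum is itself an admissible constant: divide by the seminorm of `x`, or, if that
vanishes, use any admissible constant. -/
lemma onModule_apply_le_opNorm (T : BoundedOp A E) (p : CStarSeminorm A) (x : E) :
    p.onModule (T x) ≤ T.opNorm * p.onModule x := by
  obtain ⟨M, hM⟩ := T.isBounded_toMap
  have hne : {M | 0 ≤ M ∧ ∀ (p : CStarSeminorm A) (x : E),
      p.onModule (T x) ≤ M * p.onModule x}.Nonempty := by
    refine ⟨max M 0, le_max_right _ _, fun p x => ?_⟩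
    rw [← toMap_apply]
    exact (hM p x).trans (mul_le_mul_of_nonneg_right (le_max_left _ _) (p.onModule_nonneg x))
  rcases (p.onModule_nonneg x).eq_or_lt with h | h
  · obtain ⟨N, -, hN⟩ := hne
    have := hN p x
    rwa [← h, mul_zero] at this ⊢
  · rw [← div_le_iff₀ h]
    exact le_csInf hne fun N hN => (div_le_iff₀ h).2 (hN.2 p x)

variable (A E) in
/-- The operator norm as a ring norm. -/
def opRingNorm : RingNorm (BoundedOp A E) where
  toFun := opNorm
  map_zero' := le_antisymm (opNorm_le le_rfl fun p x => by
    rw [zero_apply, p.onModule_zero, zero_mul]) (opNorm_nonneg _)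
  add_le' S T := opNorm_le (add_nonneg S.opNorm_nonneg T.opNorm_nonneg) fun p x => by
    rw [add_apply, add_mul]
    exact (p.onModule_add_le _ _).trans
      (add_le_add (S.onModule_apply_le_opNorm p x) (T.onModule_apply_le_opNorm p x))
  neg' T := by
    simp only [opNorm, neg_apply, ← CStarSeminorm.moduleSeminorm_apply, map_neg_eq_map]
  mul_le' S T := opNorm_le (mul_nonneg S.opNorm_nonneg T.opNorm_nonneg) fun p x => by
    rw [mul_apply, mul_assoc]
    exact (S.onModule_apply_le_opNorm p _).trans
      (mul_le_mul_of_nonneg_left (T.onModule_apply_le_opNorm p x) S.opNorm_nonneg)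
  eq_zero_of_map_eq_zero' T hT := ext fun x => by
    refine eq_zero_of_forall_onModule (A := A) fun p => le_antisymm ?_ (p.onModule_nonneg _)
    have := T.onModule_apply_le_opNorm p x
    rwa [show T.opNorm = 0 from hT, zero_mul] at this

instance : NormedRing (BoundedOp A E) := (opRingNorm A E).toNormedRing

lemma norm_le {T : BoundedOp A E} {M : ℝ} (hM : 0 ≤ M)
    (h : ∀ (p : CStarSeminorm A) (x : E), p.onModule (T x) ≤ M * p.onModule x) : ‖T‖ ≤ M :=
  opNorm_le hM h

lemma onModule_apply_le (T : BoundedOp A E) (p : CStarSeminorm A) (x : E) :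
    p.onModule (T x) ≤ ‖T‖ * p.onModule x :=
  T.onModule_apply_le_opNorm p x

instance : NormedAlgebra ℂ (BoundedOp A E) where
  norm_smul_le c T := norm_le (mul_nonneg (norm_nonneg _) (norm_nonneg _)) fun p x => by
    rw [smul_apply, p.onModule_smul, mul_assoc]
    exact mul_le_mul_of_nonneg_left (T.onModule_apply_le p x) (norm_nonneg c)

/-- As for Hilbert spaces, `⟨Tx, Tx⟩ = ⟨x, T*Tx⟩` and Cauchy-Schwarz bound `T` by `√‖T*T‖`, here for
every `p` with the same constant. -/
instance : CStarRing (BoundedOp A E) where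
  norm_mul_self_le T := by
    rw [← sq, ← Real.le_sqrt (norm_nonneg _) (norm_nonneg _)]
    refine norm_le (Real.sqrt_nonneg _) fun p x => ?_
    refine le_of_sq_le_sq ?_ (mul_nonneg (Real.sqrt_nonneg _) (p.onModule_nonneg x))
    rw [p.onModule_sq, inner_apply_left, mul_pow, Real.sq_sqrt (norm_nonneg _), sq]
    refine (p.apply_inner_le _ _).trans ?_
    have := mul_le_mul_of_nonneg_left ((star T * T).onModule_apply_le p x) (p.onModule_nonneg x)
    rw [mul_apply] at this
    linarith

end BoundedOp

end BoundedOperators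

/-! ### `b(L(E))` as a C*-algebra, and inverse square roots in it. -/

section Complete

variable {A : Type u} {E : Type v} [NonUnitalRing A] [StarRing A] [Module ℂ A]
  [UniformSpace A] [ProCStarAlgebra A] [PartialOrder A] [StarOrderedRing A]
  [AddCommGroup E] [Module ℂ E] [SMul Aᵐᵒᵖ E] [Inner A E] [UniformSpace E] [IsHilbertModule A E]

namespace BoundedOp

/-- Norm Cauchy sequences converge pointwise. -/
lemma exists_tendsto_apply {u : ℕ → BoundedOp A E} (hu : CauchySeq u) (x : E) :
    ∃ y, Tendsto (fun n => u n x) atTop (𝓝 y) := by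
  refine exists_tendsto_of_onModule_le A _ fun p =>
    ⟨fun i => ‖u i.1 - u i.2‖ * p.onModule x, ?_, fun i => (u i.1 - u i.2).onModule_apply_le p x⟩
  have := (cauchySeq_iff_tendsto_dist_atTop_0.1 hu).mul_const (p.onModule x)
  simpa only [dist_eq_norm, zero_mul] using this

/-- The involution is isometric, so a Cauchy sequence and its adjoints both converge pointwise, and
continuity of the inner product makes the two limits adjoint to each other. -/
instance : CompleteSpace (BoundedOp A E) := by
  refine Metric.complete_of_cauchySeq_tendsto fun u hu => ?_
  have hus : CauchySeq fun n => star (u n) :=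
    hu.map (starₗᵢ ℂ (E := BoundedOp A E)).isometry.uniformContinuous
  choose f hf using exists_tendsto_apply hu
  choose g hg using exists_tendsto_apply hus
  have hfg : ∀ x y, inner A (f x) y = inner A x (g y) := fun x y => by
    refine tendsto_nhds_unique (tendsto_inner_left y (hf x)) ?_
    simpa only [inner_apply_left] using tendsto_inner_right x (hg y)
  let T : AdjointableMap A E E := .ofInner f g hfg
  -- Letting `m → ∞` keeps a bound independent of `p` and `x`; it yields first boundedness of the
  -- limit, then norm convergence.
  have key : ∀ (n : ℕ) (r : ℝ), (∀ m ≥ n, ‖u m - u n‖ ≤ r) → ∀ (p : CStarSeminorm A) (x : E),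
      p.onModule (f x - u n x) ≤ r * p.onModule x := by
    intro n r hr p x
    have h1 : Tendsto (fun m => u m x - u n x) atTop (𝓝 (f x - u n x)) :=
      (tendsto_iff_onModule A _ _).2 fun q => by
        simpa using (tendsto_iff_onModule A _ _).1 (hf x) q
    refine le_of_tendsto (tendsto_onModule p h1) ?_
    filter_upwards [eventually_ge_atTop n] with m hm
    exact ((u m - u n).onModule_apply_le p x).trans
      (mul_le_mul_of_nonneg_right (hr m hm) (p.onModule_nonneg x))
  have hT : T.IsBounded := by
    obtain ⟨n, hn⟩ := Metric.cauchySeq_iff'.1 hu 1 one_pos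
    refine ⟨1 + ‖u n‖, fun p x => ?_⟩
    have h1 := key n 1 (fun m hm => by rw [← dist_eq_norm]; exact (hn m hm).le) p x
    have h2 := p.onModule_add_le (f x - u n x) (u n x)
    rw [sub_add_cancel] at h2
    have h3 := (u n).onModule_apply_le p x
    change p.onModule (f x) ≤ _
    linarith
  refine ⟨T.toBoundedOp hT, Metric.tendsto_atTop.2 fun ε hε => ?_⟩
  obtain ⟨N, hN⟩ := Metric.cauchySeq_iff.1 hu (ε / 2) (half_pos hε)
  refine ⟨N, fun n hn => ?_⟩
  rw [dist_comm, dist_eq_norm]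
  refine (norm_le (half_pos hε).le (key n (ε / 2) fun m hm => ?_)).trans_lt (half_lt_self hε)
  rw [← dist_eq_norm]
  exact (hN m (hm.trans' hn) n hn).le

instance : CStarAlgebra (BoundedOp A E) where

/-- `⟨T x, T x⟩ ≤ ‖T‖² ⟨x, x⟩`. -/
lemma inner_apply_self_le (T : BoundedOp A E) (x : E) :
    inner A (T x) (T x) ≤ ((‖T‖ ^ 2 : ℝ) : ℂ) • inner A x x := by
  let _ : PartialOrder (BoundedOp A E) := CStarAlgebra.spectralOrder _
  have _ : StarOrderedRing (BoundedOp A E) := CStarAlgebra.spectralOrderedRing _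
  -- Writing `‖T‖² - T*T = Q*Q` turns spectral positivity into positivity of `⟨Qx, Qx⟩`.
  obtain ⟨Q, hQ⟩ := CStarAlgebra.nonneg_iff_eq_star_mul_self.1
    (sub_nonneg.2 (CStarAlgebra.star_mul_le_algebraMap_norm_sq (a := T)))
  have e : (algebraMap ℝ (BoundedOp A E) (‖T‖ ^ 2)) x = ((‖T‖ ^ 2 : ℝ) : ℂ) • x := rfl
  have h := IsPreHilbertModule.inner_self_nonneg (A := A) (Q x)
  rw [inner_apply_left, ← mul_apply, ← hQ, sub_apply, inner_sub_right', mul_apply,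
    ← inner_apply_left, e, inner_smul_right'] at h
  exact sub_nonneg.1 h

/-- A self-adjoint `S` with `C ≤ S ≤ D` in the sense of forms satisfies `‖1 - D⁻¹ S‖ < 1`. -/
lemma norm_one_sub_lt_one (S : BoundedOp A E) (hS : star S = S) {C D : ℝ} (hC : 0 < C) (hD : 0 < D)
    (h1 : ∀ x : E, (C : ℂ) • inner A x x ≤ inner A x (S x))
    (h2 : ∀ x : E, inner A x (S x) ≤ (D : ℂ) • inner A x x) : ‖1 - (D⁻¹ : ℂ) • S‖ < 1 := by
  set K := 1 - (D⁻¹ : ℂ) • S with hK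
  have hKs : star K = K := by rw [hK, star_sub, star_one, star_smul, hS]; simp
  have hKx : ∀ x : E, inner A x (K x) = inner A x x - ((D⁻¹ : ℝ) : ℂ) • inner A x (S x) := by
    intro x
    rw [hK, sub_apply, one_apply, smul_apply, inner_sub_right', inner_smul_right',
      Complex.ofReal_inv]
  have hD' : (D⁻¹ : ℂ) * D = 1 := inv_mul_cancel₀ (by exact_mod_cast hD.ne')
  have hpos : ∀ x : E, 0 ≤ inner A x (K x) := fun x => by
    have := ofReal_smul_le_smul (inv_nonneg.2 hD.le) (h2 x)
    rwa [smul_smul, Complex.ofReal_inv, hD', one_smul, ← Complex.ofReal_inv, ← sub_nonneg,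
      ← hKx] at this
  -- If `E = 0` nothing forces `C ≤ D`; the minimum keeps `r` nonnegative.
  set m := min C D with hm
  set r : ℝ := 1 - D⁻¹ * m with hr
  have hm0 : 0 < m := lt_min hC hD
  have hr0 : 0 ≤ r := by
    rw [hr, sub_nonneg, inv_mul_le_iff₀ hD, mul_one]; exact min_le_right _ _
  have hr1 : r < 1 := sub_lt_self 1 (mul_pos (inv_pos.2 hD) hm0)
  have hle : ∀ x : E, inner A x (K x) ≤ (r : ℂ) • inner A x x := fun x => by
    have h3 := ofReal_smul_le_smul (inv_nonneg.2 hD.le)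
      ((ofReal_smul_le_smul_right (min_le_left C D)
        (IsPreHilbertModule.inner_self_nonneg (A := A) x)).trans (h1 x))
    rw [hKx, hr, Complex.ofReal_sub, Complex.ofReal_one, sub_smul, one_smul, Complex.ofReal_mul,
      mul_smul]
    exact sub_le_sub_left h3 _
  have hple : ∀ (p : CStarSeminorm A) (x : E),
      p.toSeminorm (inner A x (K x)) ≤ r * p.onModule x ^ 2 := fun p x => by
    refine (CStarSeminorm.mono (hpos x) (hle x)).trans_eq ?_
    rw [map_smul_eq_mul, Complex.norm_real, Real.norm_of_nonneg hr0, p.onModule_sq]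
  refine (norm_le hr0 fun p x => ?_).trans_lt hr1
  have hKi : ∀ x y : E, inner A (K x) y = inner A x (K y) := fun x y => by
    rw [inner_apply_left, hKs]
  exact (AdjointableMap.ofInner K K hKi).onModule_apply_le_of_nonneg hKi hpos hr0 p (hple p) x

/-- Neumann series for `D⁻¹S`, which is within distance less than one of the identity. -/
lemma isUnit_of_bounds (S : BoundedOp A E) (hS : star S = S) {C D : ℝ} (hC : 0 < C) (hD : 0 < D)
    (h1 : ∀ x : E, (C : ℂ) • inner A x x ≤ inner A x (S x))
    (h2 : ∀ x : E, inner A x (S x) ≤ (D : ℂ) • inner A x x) : IsUnit S := by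
  have h := isUnit_one_sub_of_norm_lt_one (norm_one_sub_lt_one S hS hC hD h1 h2)
  rw [sub_sub_cancel] at h
  have hD' : (D : ℂ)⁻¹ ≠ 0 := inv_ne_zero (by exact_mod_cast hD.ne')
  exact (isUnit_smul_iff (Units.mk0 _ hD') S).1 h

/-- A self-adjoint element of `b(L(E))` that is bounded from below by a positive constant is of
the form `q⁻²` where `q` is of the form `r²` with `r` self-adjoint. -/
lemma exists_inv_sqrt (S : BoundedOp A E) (hS : star S = S) {C D : ℝ} (hC : 0 < C) (hD : 0 < D)
    (h1 : ∀ x : E, (C : ℂ) • inner A x x ≤ inner A x (S x))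
    (h2 : ∀ x : E, inner A x (S x) ≤ (D : ℂ) • inner A x x) :
    ∃ r q q' : BoundedOp A E, star r = r ∧ r * r = q ∧ q * q' = 1 ∧ q' * q = 1 ∧
      q * q * S = 1 ∧ S * (q * q) = 1 := by
  let _ : PartialOrder (BoundedOp A E) := CStarAlgebra.spectralOrder _
  have _ : StarOrderedRing (BoundedOp A E) := CStarAlgebra.spectralOrderedRing _
  obtain ⟨u, hu⟩ := isUnit_of_bounds S hS hC hD h1 h2
  -- Spectral positivity comes from the norm estimate: `1 - D⁻¹S` is self-adjoint of norm below one,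
  -- hence at most `1`.
  have hpos : 0 ≤ S := by
    have h := IsSelfAdjoint.le_algebraMap_norm_self (a := 1 - (D⁻¹ : ℂ) • S) (by
      rw [IsSelfAdjoint, star_sub, star_one, star_smul, hS]; simp)
    have h' : algebraMap ℝ (BoundedOp A E) ‖1 - (D⁻¹ : ℂ) • S‖ ≤ 1 := by
      simpa only [map_one] using
        algebraMap_mono (BoundedOp A E) (norm_one_sub_lt_one S hS hC hD h1 h2).le
    have h3 : 0 ≤ (D⁻¹ : ℂ) • S := by simpa using h.trans h'
    have h4 := ofReal_smul_nonneg hD.le h3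
    rwa [smul_smul, mul_inv_cancel₀ (by exact_mod_cast hD.ne'), one_smul] at h4
  rw [← hu] at hpos
  have hinv : 0 ≤ ((u⁻¹ : (BoundedOp A E)ˣ) : BoundedOp A E) := CFC.inv_nonneg_of_nonneg u hpos
  set q := CFC.sqrt ((u⁻¹ : (BoundedOp A E)ˣ) : BoundedOp A E) with hq
  have hqq : q * q = ((u⁻¹ : (BoundedOp A E)ˣ) : BoundedOp A E) := CFC.sqrt_mul_sqrt_self _ hinv
  have hqS : q * (q * S) = 1 := by rw [← mul_assoc, hqq, ← hu, Units.inv_mul]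
  have hSq : S * q * q = 1 := by rw [mul_assoc, hqq, ← hu, Units.mul_inv]
  -- The second root `r = √q` exhibits `q` as `r* r`, the form of positivity required in `L(E)`.
  refine ⟨CFC.sqrt q, q, q * S, (IsSelfAdjoint.of_nonneg (CFC.sqrt_nonneg q)).star_eq,
    CFC.sqrt_mul_sqrt_self q (CFC.sqrt_nonneg _), hqS, ?_, by rw [mul_assoc, hqS],
    by rw [← mul_assoc, hSq]⟩
  -- `Sq` is a left and `qS` a right inverse of `q`, so they coincide.
  rw [← left_inv_eq_right_inv hSq hqS, hSq]

end BoundedOp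

end Complete

/-! ### Analysis, synthesis and the frame operator. -/

section Frames

variable {A : Type u} {E : Type v} [NonUnitalRing A] [StarRing A] [Module ℂ A]
  [UniformSpace A] [ProCStarAlgebra A] [PartialOrder A] [StarOrderedRing A]
  [AddCommGroup E] [Module ℂ E] [SMul Aᵐᵒᵖ E] [Inner A E] [UniformSpace E] [IsHilbertModule A E]

lemma tendsto_seminorm (p : CStarSeminorm A) {ι : Type*} {l : Filter ι} {f : ι → A} {a : A}
    (h : Tendsto f l (𝓝 a)) : Tendsto (fun i => p.toSeminorm (f i)) l (𝓝 (p.toSeminorm a)) :=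
  (p.continuous_toSeminorm.tendsto a).comp h

/-- The seminorm of a finite partial sum of a convergent positive series is at most that of the
sum of the series. -/
lemma CStarSeminorm.sum_Ico_le_of_tendsto (p : CStarSeminorm A) {f : ℕ → A} (hf : ∀ k, 0 ≤ f k)
    {s : A} (hs : Tendsto (fun n => ∑ k ∈ range n, f k) atTop (𝓝 s)) (m n : ℕ) :
    p.toSeminorm (∑ k ∈ Ico m n, f k) ≤ p.toSeminorm s := by
  refine ge_of_tendsto (tendsto_seminorm p hs) ?_
  filter_upwards [eventually_ge_atTop n] with N hN
  refine mono (sum_nonneg fun k _ => hf k) (sum_le_sum_of_subset_of_nonneg ?_ fun k _ _ => hf k)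
  exact fun k hk => mem_range.2 ((mem_Ico.1 hk).2.trans_le hN)

lemma Multiplier.inner_apply_left (h : Multiplier A E) (a : A) (x : E) :
    inner A (h a) x = star a * h.innerRight x :=
  h.inner_map a x

lemma Multiplier.inner_apply_right (h : Multiplier A E) (a : A) (x : E) :
    inner A x (h a) = innerLeft x h * a := by
  rw [← star_inner', inner_apply_left, star_mul, star_star, innerLeft]

variable {h : ℕ → Multiplier A E} {C D : ℝ}

lemma tendsto_inner_frameTransform (hh : IsStandardFrame h) (x : E) :
    Tendsto (fun n => ∑ k ∈ range n, Multiplier.innerLeft x (h k) * (h k).innerRight x) atTop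
      (𝓝 (inner A (frameTransform h hh x) (frameTransform h hh x))) :=
  HA.tendsto_inner (frameTransform h hh x) (frameTransform h hh x)

lemma IsStandardFrameWith.inner_frameTransform (hf : IsStandardFrameWith C D h)
    (hh : IsStandardFrame h) (x : E) :
    (C : ℂ) • inner A x x ≤ inner A (frameTransform h hh x) (frameTransform h hh x) ∧
      inner A (frameTransform h hh x) (frameTransform h hh x) ≤ (D : ℂ) • inner A x x := by
  obtain ⟨s, hs, h1, h2⟩ := hf x
  rw [tendsto_nhds_unique (tendsto_inner_frameTransform hh x) hs]
  exact ⟨h1, h2⟩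

/-- The synthesis estimate for a standard frame with upper bound `D`. -/
lemma IsStandardFrameWith.onModule_sum_sq_le (hf : IsStandardFrameWith C D h) (hC : 0 ≤ C)
    (hD : 0 ≤ D) (p : CStarSeminorm A) (a : ℕ → A) (m n : ℕ) :
    p.onModule (∑ k ∈ Ico m n, h k (a k)) ^ 2 ≤
      D * p.toSeminorm (∑ k ∈ Ico m n, star (a k) * a k) := by
  set x := ∑ k ∈ Ico m n, h k (a k) with hx
  have e : inner A x x = ∑ k ∈ Ico m n, star (a k) * (h k).innerRight x := by
    conv_lhs => rw [hx, inner_sum_left']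
    exact sum_congr rfl fun k _ => Multiplier.inner_apply_left _ _ _
  obtain ⟨s, hs, h1, h2⟩ := hf x
  have hs0 : 0 ≤ s :=
    (ofReal_smul_nonneg hC (IsPreHilbertModule.inner_self_nonneg (A := A) x)).trans h1
  have h3 : p.toSeminorm (∑ k ∈ Ico m n, star ((h k).innerRight x) * (h k).innerRight x) ≤
      D * p.onModule x ^ 2 := by
    refine (p.sum_Ico_le_of_tendsto (fun k => star_mul_self_nonneg _) hs m n).trans
      ((CStarSeminorm.mono hs0 h2).trans_eq ?_)
    rw [map_smul_eq_mul, Complex.norm_real, Real.norm_of_nonneg hD, p.onModule_sq]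
  -- Cauchy-Schwarz applied to `⟨x, x⟩ = ∑ aₖ* ⟨hₖ, x⟩`; by `h3` the coefficient factor costs `D`
  -- times the squared seminorm of `x`, which then cancels.
  have h4 := p.sum_sq_le (Ico m n) a fun k => (h k).innerRight x
  rw [← e, ← p.onModule_sq] at h4
  rcases (p.onModule_nonneg x).eq_or_lt with h0 | h0
  · rw [← h0, zero_pow two_ne_zero]
    exact mul_nonneg hD (apply_nonneg _ _)
  refine le_of_mul_le_mul_right ?_ (pow_pos h0 2)
  rw [← sq]
  refine (h4.trans (mul_le_mul_of_nonneg_right h3 (apply_nonneg _ _))).trans_eq ?_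
  ring

/-- The synthesis estimate controls differences of partial sums by those of the convergent series `∑
aₖ* aₖ`, and `E` is complete. -/
lemma IsStandardFrame.exists_tendsto_synthesis (hh : IsStandardFrame h) (a : HA A) :
    ∃ y : E, Tendsto (fun n => ∑ k ∈ range n, h k (a.1 k)) atTop (𝓝 y) := by
  obtain ⟨C, D, hC, hD, hf⟩ := hh
  refine exists_tendsto_of_onModule_le A _ fun p => ⟨fun i => √(D * p.toSeminorm
    (∑ k ∈ range i.1, star (a.1 k) * a.1 k - ∑ k ∈ range i.2, star (a.1 k) * a.1 k)), ?_, ?_⟩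
  · obtain ⟨s, hs⟩ := a.2
    have h1 : Tendsto (fun i : ℕ × ℕ => ∑ k ∈ range i.1, star (a.1 k) * a.1 k -
        ∑ k ∈ range i.2, star (a.1 k) * a.1 k) atTop (𝓝 (s - s)) := by
      rw [← prod_atTop_atTop_eq]
      exact (hs.comp tendsto_fst).sub (hs.comp tendsto_snd)
    have h2 := ((tendsto_seminorm p h1).const_mul D).sqrt
    simpa using h2
  · have aux : ∀ m n : ℕ, m ≤ n →
        p.onModule (∑ k ∈ range n, h k (a.1 k) - ∑ k ∈ range m, h k (a.1 k)) ≤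
          √(D * p.toSeminorm
            (∑ k ∈ range n, star (a.1 k) * a.1 k - ∑ k ∈ range m, star (a.1 k) * a.1 k)) := by
      intro m n hmn
      rw [← sum_Ico_eq_sub _ hmn, ← sum_Ico_eq_sub _ hmn]
      exact Real.le_sqrt_of_sq_le (hf.onModule_sum_sq_le hC.le hD.le p a.1 m n)
    rintro ⟨m, n⟩
    dsimp only
    rcases le_total n m with hmn | hmn
    · exact aux n m hmn
    · rw [p.onModule_sub_rev, map_sub_rev p.toSeminorm]
      exact aux m n hmn

/-- The synthesis operator `(aₙ) ↦ ∑ hₙ(aₙ)` of a standard frame. -/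
def IsStandardFrame.synthesis (hh : IsStandardFrame h) (a : HA A) : E :=
  (hh.exists_tendsto_synthesis a).choose

/-- Both sides are limits of the same partial sums `∑ ⟨x, hₖ⟩ aₖ`. -/
lemma IsStandardFrame.inner_frameTransform_left (hh : IsStandardFrame h) (x : E) (a : HA A) :
    inner A (frameTransform h hh x) a = inner A x (hh.synthesis a) := by
  refine tendsto_nhds_unique (HA.tendsto_inner _ _)
    ((tendsto_inner_right x (hh.exists_tendsto_synthesis a).choose_spec).congr fun n => ?_)
  rw [inner_sum_right']
  exact sum_congr rfl fun k _ => Multiplier.inner_apply_right _ _ _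

/-- The frame transform as an adjointable map. -/
def IsStandardFrame.analysis (hh : IsStandardFrame h) : AdjointableMap A E (HA A) where
  toFun := frameTransform h hh
  map_add' x y := Subtype.ext (funext fun n => map_add (h n).adj x y)
  map_smul' c x := Subtype.ext (funext fun n => map_smul (h n).adj c x)
  map_op_smul x a := Subtype.ext (funext fun n => (h n).adj_op_smul x a)
  -- The synthesis map is defined by choosing limits; its linearity is read off from adjointness.
  adj := linearMapOfInner hh.synthesis (frameTransform h hh) hh.inner_frameTransform_left
  adj_op_smul := map_op_smul_of_inner _ _ hh.inner_frameTransform_left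
  inner_map := hh.inner_frameTransform_left

/-- The frame operator is bounded. -/
lemma IsStandardFrame.isBounded_frameOperator (hh : IsStandardFrame h) :
    (hh.analysis.adjoint.comp hh.analysis).IsBounded := by
  obtain ⟨C, D, hC, hD, hf⟩ := id hh
  have hi := fun x => hf.inner_frameTransform hh x
  -- `S` is positive and its form is at most `D⟨x, x⟩`, so the upper frame bound serves for all `p`.
  refine ⟨D, fun p x => ?_⟩
  set S := hh.analysis.adjoint.comp hh.analysis with hS
  have hSi : ∀ x y : E, inner A x (S y) =
      inner A (frameTransform h hh x) (frameTransform h hh y) :=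
    fun x y => (hh.analysis.inner_map x _).symm
  have hSs : ∀ x y : E, inner A (S x) y = inner A x (S y) := fun x y => by
    rw [← star_inner', hSi, star_inner', hSi]
  have hpos : ∀ x : E, 0 ≤ inner A x (S x) := fun x => by
    rw [hSi]
    exact (ofReal_smul_nonneg hC.le (IsPreHilbertModule.inner_self_nonneg (A := A) x)).trans
      (hi x).1
  have hple : ∀ x : E, p.toSeminorm (inner A x (S x)) ≤ D * p.onModule x ^ 2 := fun x => by
    refine (CStarSeminorm.mono (hpos x) ((hSi x x).trans_le (hi x).2)).trans_eq ?_
    rw [map_smul_eq_mul, Complex.norm_real, Real.norm_of_nonneg hD.le, p.onModule_sq]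
  exact S.onModule_apply_le_of_nonneg hSs hpos hD.le p hple x

/-- If `T` is self-adjoint and `T S T = 1` for the frame operator `S`, then `T` transforms the frame
into a normalised one. -/
lemma IsStandardFrame.isStandardNormalisedFrame (hh : IsStandardFrame h)
    (T : AdjointableMap A E E) (hT : ∀ x y : E, inner A (T x) y = inner A x (T y))
    (hTS : ∀ x : E, T (hh.analysis.adjoint (hh.analysis (T x))) = x) :
    IsStandardNormalisedFrame fun n => T.comp (h n) := by
  have hadj : ∀ x, T.adj x = T x := fun x => ext_inner_left' A fun y => by
    rw [← T.inner_map, hT]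
  intro x
  have key : inner A (frameTransform h hh (T x)) (frameTransform h hh (T x)) = inner A x x :=
    (hh.analysis.inner_map (T x) _).trans ((hT _ _).trans (congrArg _ (hTS x)))
  refine ⟨inner A x x, ?_, by simp, by simp⟩
  rw [← key]
  refine (tendsto_inner_frameTransform hh (T x)).congr fun n => sum_congr rfl fun k _ => ?_
  -- The adjoint of `T ∘ hₖ` is `hₖ* ∘ T*`, and `T* = T`.
  rw [← hadj x]
  rfl

/-- A sequence that a bounded invertible map transforms into a normalised frame is a frame. -/
lemma isStandardFrame_of_isBoundedInvertible (T : AdjointableMap A E E)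
    (hT : T.IsBoundedInvertible) (hf : IsStandardNormalisedFrame fun n => T.comp (h n)) :
    IsStandardFrame h := by
  obtain ⟨hTb, R, hRb, hTR⟩ := hT
  -- Here `t = T*` and `r = R*` with `R = T⁻¹`, so `r x` is the point `(T*)⁻¹x`.
  let t := T.adjoint.toBoundedOp (AdjointableMap.isBounded_adjoint hTb)
  let r := R.adjoint.toBoundedOp (AdjointableMap.isBounded_adjoint hRb)
  have htr : ∀ x, t (r x) = x := fun x => ext_inner_left' A fun y => by
    change inner A y (T.adj (R.adj x)) = _
    rw [← T.inner_map, ← R.inner_map, (hTR y).2]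
  -- The added ones keep both constants positive even when the norms vanish.
  refine ⟨(‖t‖ ^ 2 + 1)⁻¹, ‖r‖ ^ 2 + 1, by positivity, by positivity, fun x => ?_⟩
  obtain ⟨s, hs, h1, h2⟩ := hf (r x)
  rw [Complex.ofReal_one, one_smul] at h1 h2
  obtain rfl := le_antisymm h1 h2
  have hnn := fun y : E => IsPreHilbertModule.inner_self_nonneg (A := A) y
  refine ⟨_, hs.congr fun n => sum_congr rfl fun k _ => ?_, ?_, ?_⟩
  · have e : Multiplier.innerRight (T.comp (h k)) (r x) = (h k).innerRight x :=
      congrArg (h k).adj (htr x)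
    rw [Multiplier.innerLeft, Multiplier.innerLeft, e]
  · have h3 := (t.inner_apply_self_le (r x)).trans
      (ofReal_smul_le_smul_right (le_add_of_nonneg_right zero_le_one) (hnn (r x)))
    rw [htr] at h3
    have h4 := ofReal_smul_le_smul (c := (‖t‖ ^ 2 + 1)⁻¹) (by positivity) h3
    rwa [smul_smul, ← Complex.ofReal_mul, inv_mul_cancel₀ (by positivity), Complex.ofReal_one,
      one_smul] at h4
  · exact (r.inner_apply_self_le x).trans
      (ofReal_smul_le_smul_right (le_add_of_nonneg_right zero_le_one) (hnn x))

/-- The inverse square root of the frame operator. -/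
lemma IsStandardFrame.exists_isInvSqrt (hh : IsStandardFrame h) :
    ∃ T : AdjointableMap A E E, T.IsInvSqrt (hh.analysis.adjoint.comp hh.analysis) ∧
      T.IsBoundedInvertible ∧ IsStandardNormalisedFrame fun n => T.comp (h n) := by
  obtain ⟨C, D, hC, hD, hf⟩ := id hh
  have hi := fun x => hf.inner_frameTransform hh x
  let S := (hh.analysis.adjoint.comp hh.analysis).toBoundedOp hh.isBounded_frameOperator
  have hSi : ∀ x y : E, inner A x (S y) =
      inner A (frameTransform h hh x) (frameTransform h hh y) :=
    fun x y => (hh.analysis.inner_map x _).symm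
  have hS : star S = S := (BoundedOp.eq_star_of_inner fun x y => by
    rw [← star_inner', hSi, star_inner', hSi]).symm
  obtain ⟨r, q, q', hr, hrq, hqq', hq'q, h1, h2⟩ := S.exists_inv_sqrt hS hC hD
    (fun x => (hi x).1.trans_eq (hSi x x).symm) (fun x => (hSi x x).trans_le (hi x).2)
  have hq : star q = q := by rw [← hrq, star_mul, hr]
  have happ : ∀ {s t : BoundedOp A E}, s = t → ∀ x, s x = t x := fun e x => by rw [e]
  -- Cancelling one `q` in `q q S = 1` gives `qS = q⁻¹`.
  have hqS : q * S * q = 1 := by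
    have : q * S = q' := by
      calc q * S = q' * (q * q * S) := by rw [← mul_assoc, ← mul_assoc, hq'q, one_mul]
        _ = q' := by rw [h1, mul_one]
    rw [this, hq'q]
  refine ⟨q.toMap, ⟨⟨r.toMap, fun x => ?_⟩, fun x => ⟨?_, ?_⟩⟩,
    ⟨q.isBounded_toMap, q'.toMap, q'.isBounded_toMap, fun x => ?_⟩,
    hh.isStandardNormalisedFrame _ (fun x y => ?_) fun x => ?_⟩
  · rw [BoundedOp.toMap_apply, ← hrq, BoundedOp.mul_apply, BoundedOp.toMap_apply]
    -- By definition `star r` acts as the adjoint of `r.toMap`, so `star r = r` is what is needed.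
    exact congrArg (fun t : BoundedOp A E => t (r x)) hr.symm
  · rw [BoundedOp.toMap_apply, BoundedOp.toMap_apply]
    exact happ h1 x
  · rw [BoundedOp.toMap_apply, BoundedOp.toMap_apply]
    exact happ h2 x
  · simp only [BoundedOp.toMap_apply]
    exact ⟨happ hqq' x, happ hq'q x⟩
  · rw [BoundedOp.toMap_apply, BoundedOp.toMap_apply, BoundedOp.inner_apply_left, hq]
  · rw [BoundedOp.toMap_apply, BoundedOp.toMap_apply]
    exact happ hqS x

end Frames

end ProCStar

end

open ProCStar
theorem theorem3p12 {A E : Type*}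
    [NonUnitalRing A] [StarRing A] [Module ℂ A] [UniformSpace A] [ProCStarAlgebra A]
    [PartialOrder A] [StarOrderedRing A]
    [AddCommGroup E] [Module ℂ E] [SMul Aᵐᵒᵖ E] [Inner A E] [UniformSpace E]
    [IsHilbertModule A E]
    (hE : IsCountablyGeneratedInMultipliers A E) (h : ℕ → Multiplier A E) :
    (IsStandardFrame h ↔
      ∃ T : AdjointableMap A E E, T.IsBoundedInvertible ∧
        IsStandardNormalisedFrame fun n => T.comp (h n)) ∧
    ∀ hh : IsStandardFrame h,
      ∃ θ : AdjointableMap A E (HA A), (∀ x : E, θ x = frameTransform h hh x) ∧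
        ∃ T : AdjointableMap A E E, T.IsInvSqrt (θ.adjoint.comp θ) ∧
          T.IsBoundedInvertible ∧ IsStandardNormalisedFrame fun n => T.comp (h n) := by
  refine ⟨⟨fun hh => ?_, fun ⟨T, hT, hf⟩ => isStandardFrame_of_isBoundedInvertible T hT hf⟩,
    fun hh => ⟨hh.analysis, fun _ => rfl, hh.exists_isInvSqrt⟩⟩
  obtain ⟨T, -, hT⟩ := hh.exists_isInvSqrt
  exact ⟨T, hT⟩
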